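/- Let $L \ge 1$ and $N \ge 0$ be integers and let $\lambda, \lambda_0 \in \mathbb{R}$. Let $$\mathcal{C}_L = \{ (r_1 P, \dots, r_L P) : r_1,\dots,r_L \in \mathbb{R},\ P \in \tfrac{1}{\sqrt2}\mathbb{S}^N \times \tfrac{1}{\sqrt2}\mathbb{S}^N \} \subset \mathbb{C}^{(N+1)L}$$ be the $L$-rays Clifford cone, where $\tfrac{1}{\sqrt2}\mathbb{S}^N \times \tfrac{1}{\sqrt2}\mathbb{S}^N = \{\tfrac{1}{\sqrt2}(X+iY) : X, Y \in \mathbb{R}^{N+1},\ \|X\|=\|Y\|=1\} \subset \mathbb{C}^{N+1}$, and let $$\mathcal{H} = \mathcal{H}^{\lambda,\lambda_0,L,N} = \{ (e^{i\lambda\Theta} Z,\ \lambda_0\Theta) : \Theta \in \mathbb{R},\ Z \in \mathcal{C}_L \} \subset \mathbb{C}^{(N+1)L}\times\mathbb{R} = \mathbb{R}^{L(2N+2)+1}.$$ Put $d = 2N+L+1$ if $(\lambda,\lambda_0) \ne (0,0)$ and $d = 2N+L$ if $\lambda=\lambda_0=0$. Then $\mathcal{H}$ is a $d$-dimensional minimal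 variety in $\mathbb{R}^{L(2N+2)+1}$: the set of points near which $\mathcal{H}$ is a smooth embedded $d$-dimensional submanifold is dense in $\mathcal{H}$ and contains every point of $\mathcal{H}$ outside the axis $\{0\}\times\mathbb{R}$, and the mean curvature vector of $\mathcal{H}$ vanishes at every point of that set. Moreover, $\mathcal{H}$ is invariant under the multi-screw motion with all rotational pitches equal to $\lambda$ and translational pitch $\lambda_0$: for every $\theta \in \mathbb{R}$, the map $(Z, z) \mapsto (e^{i\lambda\theta} Z,\ z + \lambda_0\theta)$ of $\mathbb{C}^{(N+1)L}\times\mathbb{R}$ maps $\mathcal{H}$ onto itself. -/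

import Mathlib

open scoped ContDiff

/-! ### Submanifolds of a Euclidean space, their second fundamental form and mean curvature -/

section Submanifold

variable {E : Type*} [NormedAddCommGroup E] [InnerProductSpace ℝ E]

/-- `f`, on the open set `U ⊆ ℝ^d`, is a local parametrization of the set `S ⊆ E` as a smooth embedded
`d`-dimensional submanifold: it is a smooth immersion and a homeomorphism onto its image, and
its image is a relatively open piece of `S`. -/
structure IsLocalParam (d : ℕ) (S : Set E) (U : Set (EuclideanSpace ℝ (Fin d)))
    (f : EuclideanSpace ℝ (Fin d) → E) : Prop where
  isOpen : IsOpen U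
  smooth : ContDiffOn ℝ ∞ f U
  immersion : ∀ u ∈ U, Function.Injective (fderiv ℝ f u)
  embedding : Topology.IsEmbedding (U.domRestrict f)
  image : ∃ V : Set E, IsOpen V ∧ f '' U = S ∩ V

/-- The regular part of `S` in dimension `d`: the points of `S` near which `S` is a smooth embedded
`d`-dimensional submanifold of `E`. -/
def regularPart (d : ℕ) (S : Set E) : Set E :=
  {p | ∃ (U : Set (EuclideanSpace ℝ (Fin d))) (f : EuclideanSpace ℝ (Fin d) → E),
    IsLocalParam d S U f ∧ p ∈ f '' U}

/-- The first fundamental form `g_{ij} = ∂_i f · ∂_j f`. -/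
noncomputable def firstFundForm {d : ℕ} (f : EuclideanSpace ℝ (Fin d) → E)
    (u : EuclideanSpace ℝ (Fin d)) : Matrix (Fin d) (Fin d) ℝ :=
  Matrix.of fun i j =>
    inner ℝ (fderiv ℝ f u (EuclideanSpace.single i 1)) (fderiv ℝ f u (EuclideanSpace.single j 1))

/-- The tangent space of the immersion `f` at the parameter `u`. -/
noncomputable def tangentRange {d : ℕ} (f : EuclideanSpace ℝ (Fin d) → E)
    (u : EuclideanSpace ℝ (Fin d)) : Submodule ℝ E :=
  LinearMap.range (fderiv ℝ f u).toLinearMap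

instance {d : ℕ} (f : EuclideanSpace ℝ (Fin d) → E) (u : EuclideanSpace ℝ (Fin d)) :
    FiniteDimensional ℝ (tangentRange f u) := by
  unfold tangentRange; infer_instance

/-- The second fundamental form: the component normal to the submanifold of the second derivative
of the parametrization. -/
noncomputable def secondFundForm {d : ℕ} (f : EuclideanSpace ℝ (Fin d) → E)
    (u v w : EuclideanSpace ℝ (Fin d)) : E :=
  (tangentRange f u)ᗮ.starProjection (fderiv ℝ (fderiv ℝ f) u v w)

/-- The mean curvature vector: the trace `∑ g^{ij} II(∂_i, ∂_j)` of the second fundamental form with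
respect to the first. -/
noncomputable def meanCurvatureVector {d : ℕ} (f : EuclideanSpace ℝ (Fin d) → E)
    (u : EuclideanSpace ℝ (Fin d)) : E :=
  ∑ i, ∑ j, (firstFundForm f u)⁻¹ i j •
    secondFundForm f u (EuclideanSpace.single i 1) (EuclideanSpace.single j 1)

/-- `S` is a `d`-dimensional minimal variety, possibly with singularities: its regular part
is dense in it, and the mean curvature vector vanishes at every regular point, whatever
local parametrization is used to compute it. -/
structure IsMinimalVariety (d : ℕ) (S : Set E) : Prop where
  dense_regular : S ⊆ closure (regularPart d S)
  meanCurvature_eq_zero : ∀ (U : Set (EuclideanSpace ℝ (Fin d))) (f : EuclideanSpace ℝ (Fin d) → E),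
    IsLocalParam d S U f → ∀ u ∈ U, meanCurvatureVector f u = 0

end Submanifold

/-! ### The multi-rays Clifford cone and the generalized helicoid -/

/-- The Euclidean space `ℝ^{L(2N+2)+1} = ℂ^{(N+1)L} × ℝ`. A vector of `ℂ^{(N+1)L}` consists of `L`
blocks in `ℂ^{N+1}`; the entry `(s, k)` is the `k`-th coordinate of the `s`-th block. -/
abbrev HelicoidSpace (L N : ℕ) : Type :=
  WithLp 2 (EuclideanSpace ℂ (Fin L × Fin (N + 1)) × ℝ)

/-- The Clifford torus `(1/√2) S^N × (1/√2) S^N` in `ℂ^{N+1} = ℝ^{N+1} + i ℝ^{N+1}`. -/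
def cliffordTorus (N : ℕ) : Set (EuclideanSpace ℂ (Fin (N + 1))) :=
  {P | ∃ X Y : EuclideanSpace ℝ (Fin (N + 1)), ‖X‖ = 1 ∧ ‖Y‖ = 1 ∧
    ∀ k, P k = ((1 / √2 : ℝ) : ℂ) * ((X k : ℂ) + Complex.I * (Y k : ℂ))}

/-- The `L`-rays cone `{(r_1 P, …, r_L P) : r_1, …, r_L ∈ ℝ, P ∈ Σ}` over a set `Σ ⊆ ℂ^n`. -/
def raysCone (L : ℕ) {n : ℕ} (T : Set (EuclideanSpace ℂ (Fin n))) :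
    Set (EuclideanSpace ℂ (Fin L × Fin n)) :=
  {Z | ∃ r : Fin L → ℝ, ∃ P ∈ T, ∀ s k, Z (s, k) = (r s : ℂ) * P k}

/-- The generalized helicoid: all points `(e^{iλΘ} Z, λ₀ Θ)` with `Θ ∈ ℝ` and `Z` in
the `L`-rays Clifford cone. -/
noncomputable def generalizedHelicoid (lam lam₀ : ℝ) (L N : ℕ) : Set (HelicoidSpace L N) :=
  {p | ∃ Θ : ℝ, ∃ Z ∈ raysCone L (cliffordTorus N),
    p = WithLp.toLp 2 (Complex.exp (Complex.I * ((lam * Θ : ℝ) : ℂ)) • Z, lam₀ * Θ)}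

/-- The multi-screw motion with angle `θ`: the `s`-th block is rotated
by `e^{i Λ_s θ}` and the last coordinate is translated by `λ₀ θ`. -/
noncomputable def multiScrewMotion {L N : ℕ} (lam₀ : ℝ) (Lam : Fin L → ℝ) (θ : ℝ)
    (p : HelicoidSpace L N) : HelicoidSpace L N :=
  WithLp.toLp 2
    (WithLp.toLp 2 fun sk : Fin L × Fin (N + 1) =>
      Complex.exp (Complex.I * ((Lam sk.1 * θ : ℝ) : ℂ)) * p.fst sk,
     p.snd + lam₀ * θ)

/-- The dimension of the generalized helicoid: that of the `L`-rays Clifford cone, `2N + L`, plus one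
for the screw parameter, which has no effect when both pitches are zero. -/
noncomputable def helicoidDim (lam lam₀ : ℝ) (L N : ℕ) : ℕ :=
  if lam = 0 ∧ lam₀ = 0 then 2 * N + L else 2 * N + L + 1

/-! ### Naturality of the mean curvature vector -/

section MeanCurvature

open Filter Topology

variable {E : Type*} [NormedAddCommGroup E] [InnerProductSpace ℝ E]

/-! No curvature is computed: minimality follows from symmetry. The mean curvature vector H at p is
independent of the parametrization, so every affine isometry that preserves the set and fixes p
fixes H (`IsLocalParam.map_meanCurvatureVector`); moreover H is normal to all curves in the set.
Write points as (e^{iλΘ} r ⊗ Q, λ₀Θ), with Q = x + iy in the cone |x| = |y|. Two symmetries fix such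
a point when r and Q are nonzero. The flip `screwFlip` reverses the axis about level Θ and exchanges
x and y through an isometry A with Ay = x and Ax = y; it kills the axial component of H. The
reflection `rayFlip` in r ⊗ ℂ^{N+1} forces the rest of H to be e^{iλΘ} r ⊗ v. Then v is fixed by the
conjugate-linear swap x + iy ↦ Ay + iAx and is normal to the cone at Q. The normal line of the cone
is spanned by x - iy, which the swap negates, so v = 0 (`eq_zero_of_normal_of_conjSwap`). On the
axis, a flip and Z ↦ -Z suffice. Regularity off the axis comes from charts with smooth left
inverses: of the cone, then of its rays (`HasSmoothChart.rays`), then of the screw family. If λ₀ = 0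
≠ λ, the rotations sweep the cone over all of ℂ^{N+1}, because any complex vector can be rotated
into it; the helicoid is then the set of rays over ℂ^{N+1}. Moving along a nonzero ray towards the
axis gives density. -/

theorem IsLocalParam.contDiffAt {d : ℕ} {S : Set E} {U : Set (EuclideanSpace ℝ (Fin d))}
    {f : EuclideanSpace ℝ (Fin d) → E} (hf : IsLocalParam d S U f) {u : EuclideanSpace ℝ (Fin d)}
    (hu : u ∈ U) : ContDiffAt ℝ ∞ f u :=
  hf.smooth.contDiffAt (hf.isOpen.mem_nhds hu)

/-- A smooth map into `S` factors locally and smoothly through any local parametrization of `S`. -/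
theorem IsLocalParam.exists_lift [FiniteDimensional ℝ E] {d : ℕ} {S : Set E}
    {U : Set (EuclideanSpace ℝ (Fin d))} {f : EuclideanSpace ℝ (Fin d) → E}
    (hf : IsLocalParam d S U f) {u : EuclideanSpace ℝ (Fin d)} (hu : u ∈ U)
    {M : Type*} [NormedAddCommGroup M] [NormedSpace ℝ M] {c : M → E} {x : M}
    (hc : ContDiffAt ℝ ∞ c x) (hcx : c x = f u) (hcS : ∀ᶠ y in 𝓝 x, c y ∈ S) :
    ∃ φ : M → EuclideanSpace ℝ (Fin d), ContDiffAt ℝ ∞ φ x ∧ φ x = u ∧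
      c =ᶠ[𝓝 x] f ∘ φ := by
  obtain ⟨V, hV, hfV⟩ := hf.image
  -- A left inverse π of the derivative makes π ∘ f a local diffeomorphism at u; with h its local
  -- inverse, the lift is h ∘ π ∘ c, which is smooth by construction.
  obtain ⟨g, hg⟩ := LinearMap.exists_leftInverse_of_injective
    (fderiv ℝ f u).toLinearMap (LinearMap.ker_eq_bot.2 (hf.immersion u hu))
  set π : E →L[ℝ] EuclideanSpace ℝ (Fin d) := LinearMap.toContinuousLinearMap g with hπ
  have hfu : ContDiffAt ℝ ∞ f u := hf.contDiffAt hu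
  have hπf : ContDiffAt ℝ ∞ (fun z => π (f z)) u := π.contDiff.contDiffAt.comp u hfu
  have hd : HasFDerivAt (fun z => π (f z))
      ((ContinuousLinearEquiv.refl ℝ (EuclideanSpace ℝ (Fin d)) :
        EuclideanSpace ℝ (Fin d) →L[ℝ] EuclideanSpace ℝ (Fin d))) u := by
    have h1 := π.hasFDerivAt.comp u (hfu.differentiableAt (by simp)).hasFDerivAt
    have h2 : (ContinuousLinearEquiv.refl ℝ (EuclideanSpace ℝ (Fin d)) :
        EuclideanSpace ℝ (Fin d) →L[ℝ] EuclideanSpace ℝ (Fin d)) = π.comp (fderiv ℝ f u) :=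
      ContinuousLinearMap.ext fun v => (LinearMap.congr_fun hg v).symm
    rw [h2]
    exact h1
  have hn : (∞ : WithTop ℕ∞) ≠ 0 := by simp
  set h := hπf.localInverse hd hn with hh
  have hhc : ContDiffAt ℝ ∞ h (π (f u)) := hπf.to_localInverse hd hn
  have hleft : ∀ᶠ z in 𝓝 u, h (π (f z)) = z :=
    (hπf.hasStrictFDerivAt' hd hn).eventually_left_inverse
  have hxV : c x ∈ V := by
    have : f u ∈ f '' U := ⟨u, hu, rfl⟩
    rw [hfV] at this
    rw [hcx]; exact this.2
  have hcV : ∀ᶠ y in 𝓝 x, c y ∈ V := hc.continuousAt.eventually (hV.mem_nhds hxV)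
  have hpre : ∀ᶠ y in 𝓝 x, ∃ z ∈ U, f z = c y := by
    filter_upwards [hcS, hcV] with y h1 h2
    have : c y ∈ f '' U := by rw [hfV]; exact ⟨h1, h2⟩
    exact this
  have hex : ∀ y, ∃ z : U, (∃ z ∈ U, f z = c y) → f z = c y := by
    intro y
    by_cases hy : ∃ z ∈ U, f z = c y
    · obtain ⟨z, hz, hzy⟩ := hy
      exact ⟨⟨z, hz⟩, fun _ => hzy⟩
    · exact ⟨⟨u, hu⟩, fun h => absurd h hy⟩
  choose ψ hψ using hex
  have hψe : ∀ᶠ y in 𝓝 x, f (ψ y) = c y := hpre.mono fun y hy => hψ y hy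
  have hψx : (ψ x) = ⟨u, hu⟩ := by
    apply hf.embedding.injective
    change f (ψ x) = f u
    rw [hψe.self_of_nhds, hcx]
  -- The embedding property enters here: h ∘ π inverts f only near u, so `ψ y` must be known to stay
  -- near u.
  have hψc : Tendsto ψ (𝓝 x) (𝓝 ⟨u, hu⟩) := by
    rw [hf.embedding.tendsto_nhds_iff]
    change Tendsto (fun y => f (ψ y)) (𝓝 x) (𝓝 (f u))
    rw [← hcx]
    exact hc.continuousAt.tendsto.congr' (hψe.mono fun y hy => hy.symm)
  have hψc' : Tendsto (fun y => (ψ y : EuclideanSpace ℝ (Fin d))) (𝓝 x) (𝓝 u) :=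
    (continuous_subtype_val.tendsto _).comp hψc
  refine ⟨fun y => h (π (c y)), ?_, ?_, ?_⟩
  · have h1 : ContDiffAt ℝ ∞ (fun y => π (c y)) x := π.contDiff.contDiffAt.comp x hc
    refine ContDiffAt.comp x ?_ h1
    rw [hcx]; exact hhc
  · change h (π (c x)) = u
    rw [hcx]; exact hleft.self_of_nhds
  · filter_upwards [hψe, hψc'.eventually hleft] with y h1 h2
    change c y = f (h (π (c y)))
    rw [← h1, h2]

/-- Velocities of curves in `S` are tangent to `S`. -/
theorem IsLocalParam.mem_tangentRange [FiniteDimensional ℝ E] {d : ℕ} {S : Set E}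
    {U : Set (EuclideanSpace ℝ (Fin d))} {f : EuclideanSpace ℝ (Fin d) → E}
    (hf : IsLocalParam d S U f) {u : EuclideanSpace ℝ (Fin d)} (hu : u ∈ U) {c : ℝ → E}
    (hc : ContDiffAt ℝ ∞ c 0) (hc0 : c 0 = f u) (hcS : ∀ᶠ t in 𝓝 0, c t ∈ S) {v : E}
    (hv : HasDerivAt c v 0) : v ∈ tangentRange f u := by
  obtain ⟨φ, hφ, hφ0, hcφ⟩ := hf.exists_lift hu hc hc0 hcS
  have h1 : HasFDerivAt f (fderiv ℝ f u) (φ 0) := by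
    rw [hφ0]; exact ((hf.contDiffAt hu).differentiableAt (by simp)).hasFDerivAt
  have h2 := h1.comp_hasDerivAt 0 (hφ.differentiableAt (by simp)).hasDerivAt
  have h3 := (hv.congr_of_eventuallyEq hcφ.symm).unique h2
  rw [h3]
  exact ⟨_, rfl⟩

theorem meanCurvatureVector_mem_orthogonal {d : ℕ} (f : EuclideanSpace ℝ (Fin d) → E)
    (u : EuclideanSpace ℝ (Fin d)) : meanCurvatureVector f u ∈ (tangentRange f u)ᗮ :=
  Submodule.sum_mem _ fun _ _ => Submodule.sum_mem _ fun _ _ => Submodule.smul_mem _ _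
    (Submodule.starProjection_apply_mem _ _)

theorem IsLocalParam.inner_meanCurvatureVector_eq_zero [FiniteDimensional ℝ E] {d : ℕ} {S : Set E}
    {U : Set (EuclideanSpace ℝ (Fin d))} {f : EuclideanSpace ℝ (Fin d) → E}
    (hf : IsLocalParam d S U f) {u : EuclideanSpace ℝ (Fin d)} (hu : u ∈ U) {c : ℝ → E}
    (hc : ContDiffAt ℝ ∞ c 0) (hc0 : c 0 = f u) (hcS : ∀ᶠ t in 𝓝 0, c t ∈ S) {v : E}
    (hv : HasDerivAt c v 0) : inner ℝ v (meanCurvatureVector f u) = 0 :=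
  Submodule.inner_right_of_mem_orthogonal (hf.mem_tangentRange hu hc hc0 hcS hv)
    (meanCurvatureVector_mem_orthogonal f u)

theorem EuclideanSpace.map_eq_sum_smul_single {d : ℕ} {F : Type*} [AddCommGroup F] [Module ℝ F]
    (T : EuclideanSpace ℝ (Fin d) →ₗ[ℝ] F) (v : EuclideanSpace ℝ (Fin d)) :
    T v = ∑ k, v k • T (EuclideanSpace.single k 1) := by
  conv_lhs => rw [← (EuclideanSpace.basisFun (Fin d) ℝ).sum_repr v]
  simp

/-- The mean curvature vector does not depend on the parametrization. -/
theorem meanCurvatureVector_comp {d : ℕ}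
    {f f' : EuclideanSpace ℝ (Fin d) → E} {φ : EuclideanSpace ℝ (Fin d) → EuclideanSpace ℝ (Fin d)}
    {x : EuclideanSpace ℝ (Fin d)} (hf : ContDiffAt ℝ ∞ f (φ x)) (hφ : ContDiffAt ℝ ∞ φ x)
    (hff : f' =ᶠ[𝓝 x] f ∘ φ) (himm : Function.Injective (fderiv ℝ f' x)) :
    meanCurvatureVector f' x = meanCurvatureVector f (φ x) := by
  have h1 : (∞ : WithTop ℕ∞) ≠ 0 := by simp
  set A := fderiv ℝ φ x with hA
  have hd1 : fderiv ℝ f' =ᶠ[𝓝 x] fun y => (fderiv ℝ f (φ y)).comp (fderiv ℝ φ y) := by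
    have e1 : ∀ᶠ y in 𝓝 x, DifferentiableAt ℝ φ y := by
      filter_upwards [(hφ.of_le (m := 1) (by simp)).eventually (by simp)] with y hy
      exact hy.differentiableAt (by simp)
    have e2 : ∀ᶠ y in 𝓝 x, DifferentiableAt ℝ f (φ y) := by
      refine hφ.continuousAt.eventually ?_
      filter_upwards [(hf.of_le (m := 1) (by simp)).eventually (by simp)] with y hy
      exact hy.differentiableAt (by simp)
    filter_upwards [e1, e2, hff.eventuallyEq_nhds] with y h1 h2 h3
    rw [h3.fderiv_eq, fderiv_comp y h2 h1]
  have hd1x : fderiv ℝ f' x = (fderiv ℝ f (φ x)).comp A := hd1.self_of_nhds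
  -- That `f'` is an immersion forces the reparametrization to have invertible derivative.
  have hAinj : Function.Injective A := by
    intro v w hvw
    apply himm
    rw [hd1x]; simp [hvw]
  have hAsurj : Function.Surjective A :=
    (LinearMap.injective_iff_surjective (f := A.toLinearMap)).1 hAinj
  have hrange : tangentRange f' x = tangentRange f (φ x) := by
    ext v
    constructor
    · rintro ⟨w, rfl⟩
      exact ⟨A w, by simp [hd1x]⟩
    · rintro ⟨w, rfl⟩
      obtain ⟨z, rfl⟩ := hAsurj w
      exact ⟨z, by simp [hd1x]⟩
  -- The term containing the second derivative of φ is tangential, so the normal projection removes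
  -- it and the second fundamental form is tensorial.
  have hd2 : ∀ v w, fderiv ℝ (fderiv ℝ f') x v w =
      fderiv ℝ (fderiv ℝ f) (φ x) (A v) (A w) +
        fderiv ℝ f (φ x) (fderiv ℝ (fderiv ℝ φ) x v w) := by
    intro v w
    have hDf : DifferentiableAt ℝ (fderiv ℝ f) (φ x) :=
      (hf.fderiv_right (m := ∞) (by simp)).differentiableAt (by simp)
    have hDφ : DifferentiableAt ℝ (fderiv ℝ φ) x :=
      (hφ.fderiv_right (m := ∞) (by simp)).differentiableAt (by simp)
    have hφd : DifferentiableAt ℝ φ x := hφ.differentiableAt h1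
    have hDfφ : HasFDerivAt (fun y => fderiv ℝ f (φ y)) ((fderiv ℝ (fderiv ℝ f) (φ x)).comp A) x :=
      hDf.hasFDerivAt.comp x hφd.hasFDerivAt
    rw [hd1.fderiv_eq, (hDfφ.clm_comp hDφ.hasFDerivAt).fderiv]
    simp [add_comm, hA]
  have hII : ∀ v w, secondFundForm f' x v w = secondFundForm f (φ x) (A v) (A w) := by
    intro v w
    have h0 : (tangentRange f (φ x))ᗮ.starProjection
        (fderiv ℝ f (φ x) (fderiv ℝ (fderiv ℝ φ) x v w)) = 0 := by
      rw [Submodule.starProjection_apply_eq_zero_iff, Submodule.orthogonal_orthogonal]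
      exact ⟨_, rfl⟩
    unfold secondFundForm
    simp only [hrange]
    rw [hd2, map_add, h0, add_zero]
  -- The Jacobian matrix of φ; below, g' = MᵀgM gives M g'⁻¹ Mᵀ = g⁻¹, which is exactly what the
  -- trace needs.
  set Mm : Matrix (Fin d) (Fin d) ℝ :=
    Matrix.of fun k i => A (EuclideanSpace.single i 1) k with hM
  have hMdet : IsUnit Mm.det := by
    rw [isUnit_iff_ne_zero]
    intro h0
    obtain ⟨v, hv0, hv⟩ := Matrix.exists_mulVec_eq_zero_iff.2 h0
    apply hv0
    have : A (WithLp.toLp 2 v) = A 0 := by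
      ext k
      have := congrFun hv k
      rw [map_zero]
      have e := EuclideanSpace.map_eq_sum_smul_single A.toLinearMap (WithLp.toLp 2 v)
      simp only [ContinuousLinearMap.coe_coe] at e
      rw [e]
      simp only [Matrix.mulVec, dotProduct, hM, Matrix.of_apply, Pi.zero_apply] at this
      simp only [WithLp.ofLp_sum, WithLp.ofLp_smul, Finset.sum_apply, Pi.smul_apply, smul_eq_mul]
      simp only [WithLp.ofLp_zero, Pi.zero_apply]
      rw [← this]
      exact Finset.sum_congr rfl fun i _ => mul_comm _ _
    have := hAinj this
    simpa using congrArg WithLp.ofLp this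
  have hAe : ∀ i, A (EuclideanSpace.single i 1) = ∑ k, Mm k i • EuclideanSpace.single k 1 := by
    intro i
    exact EuclideanSpace.map_eq_sum_smul_single LinearMap.id _
  have hg : firstFundForm f' x = Mm.transpose * firstFundForm f (φ x) * Mm := by
    ext i j
    simp only [firstFundForm, hd1x, Matrix.of_apply, ContinuousLinearMap.comp_apply, hAe, map_sum,
      map_smul, Matrix.mul_apply, Matrix.transpose_apply, sum_inner, inner_sum,
      real_inner_smul_left, real_inner_smul_right, Finset.sum_mul]
    refine Finset.sum_congr rfl fun k _ => Finset.sum_congr rfl fun l _ => by ring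
  have hginv : Mm * (firstFundForm f' x)⁻¹ * Mm.transpose = (firstFundForm f (φ x))⁻¹ := by
    have hMt : IsUnit Mm.transpose.det := by rwa [Matrix.det_transpose]
    rw [hg, Matrix.mul_inv_rev, Matrix.mul_inv_rev, ← Matrix.mul_assoc, ← Matrix.mul_assoc,
      Matrix.mul_nonsing_inv _ hMdet, Matrix.one_mul, Matrix.mul_assoc,
      Matrix.nonsing_inv_mul _ hMt, Matrix.mul_one]
  have hIIe : ∀ i j, secondFundForm f' x (EuclideanSpace.single i 1) (EuclideanSpace.single j 1) =
      ∑ k, ∑ l, (Mm k i * Mm l j) • secondFundForm f (φ x) (EuclideanSpace.single k 1)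
        (EuclideanSpace.single l 1) := by
    intro i j
    rw [hII, hAe, hAe]
    unfold secondFundForm
    simp only [map_sum, map_smul, sum_apply, smul_apply,
      Finset.smul_sum, smul_smul]
    exact Finset.sum_comm.trans (Finset.sum_congr rfl fun k _ => Finset.sum_congr rfl fun l _ => by
      rw [mul_comm])
  unfold meanCurvatureVector
  simp only [hIIe, ← hginv, Matrix.mul_apply, Matrix.transpose_apply, Finset.smul_sum, smul_smul,
    Finset.sum_smul, Finset.sum_mul]
  calc _ = ∑ i, ∑ k, ∑ j, ∑ l, _ := Finset.sum_congr rfl fun i _ => Finset.sum_comm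
    _ = ∑ k, ∑ i, ∑ j, ∑ l, _ := Finset.sum_comm
    _ = ∑ k, ∑ i, ∑ l, ∑ j, _ := Finset.sum_congr rfl fun k _ =>
        Finset.sum_congr rfl fun i _ => Finset.sum_comm
    _ = ∑ k, ∑ l, ∑ i, ∑ j, _ := Finset.sum_congr rfl fun k _ => Finset.sum_comm
    _ = ∑ k, ∑ l, ∑ j, ∑ i, _ := Finset.sum_congr rfl fun k _ =>
        Finset.sum_congr rfl fun l _ => Finset.sum_comm
    _ = _ := by
        refine Finset.sum_congr rfl fun k _ => Finset.sum_congr rfl fun l _ =>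
          Finset.sum_congr rfl fun j _ => Finset.sum_congr rfl fun i _ => ?_
        congr 1; ring

/-- The linear part σ carries both derivatives and the normal projection along, and leaves the first
fundamental form unchanged. -/
theorem meanCurvatureVector_isometry_comp {d : ℕ} (σ : E ≃ₗᵢ[ℝ] E) (c : E)
    {f : EuclideanSpace ℝ (Fin d) → E} {x : EuclideanSpace ℝ (Fin d)} (hf : ContDiffAt ℝ ∞ f x) :
    meanCurvatureVector (fun y => σ (f y) + c) x = σ (meanCurvatureVector f x) := by
  set f' : EuclideanSpace ℝ (Fin d) → E := fun y => σ (f y) + c with hf'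
  set s : E →L[ℝ] E := (σ.toContinuousLinearEquiv : E →L[ℝ] E) with hs
  have hsσ : ∀ v, s v = σ v := fun v => rfl
  have hd1 : fderiv ℝ f' =ᶠ[𝓝 x] fun y => s.comp (fderiv ℝ f y) := by
    filter_upwards [(hf.of_le (m := 1) (by simp)).eventually (by simp)] with y hy
    have h1 : HasFDerivAt f (fderiv ℝ f y) y := (hy.differentiableAt (by simp)).hasFDerivAt
    exact ((s.hasFDerivAt.comp y h1).add_const c).fderiv
  have hd1x : ∀ v, fderiv ℝ f' x v = σ (fderiv ℝ f x v) := by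
    intro v; rw [hd1.self_of_nhds]; rfl
  have hd2 : ∀ v w, fderiv ℝ (fderiv ℝ f') x v w = σ (fderiv ℝ (fderiv ℝ f) x v w) := by
    intro v w
    have hDf : DifferentiableAt ℝ (fderiv ℝ f) x :=
      (hf.fderiv_right (m := ∞) (by simp)).differentiableAt (by simp)
    rw [hd1.fderiv_eq, ((hasFDerivAt_const s x).clm_comp hDf.hasFDerivAt).fderiv]
    simp [hsσ]
  have hrange : (tangentRange f' x)ᗮ =
      (tangentRange f x)ᗮ.map (σ.toLinearEquiv : E →ₗ[ℝ] E) := by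
    rw [Submodule.map_orthogonal_equiv]
    congr 1
    ext v
    constructor
    · rintro ⟨w, rfl⟩
      exact ⟨fderiv ℝ f x w, ⟨w, rfl⟩, (hd1x w).symm⟩
    · rintro ⟨_, ⟨w, rfl⟩, rfl⟩
      exact ⟨w, hd1x w⟩
  have hg : firstFundForm f' x = firstFundForm f x := by
    ext i j
    simp [firstFundForm, hd1x]
  have hII : ∀ v w, secondFundForm f' x v w = σ (secondFundForm f x v w) := by
    intro v w
    unfold secondFundForm
    simp only [hrange]
    rw [hd2, Submodule.starProjection_map_apply]
    simp
  unfold meanCurvatureVector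
  simp only [hg, hII, map_sum, map_smul]

/-- The mean curvature vector at a point is fixed by every isometry that fixes the point and
preserves the submanifold. -/
theorem IsLocalParam.map_meanCurvatureVector [FiniteDimensional ℝ E] {d : ℕ} {S : Set E}
    {U : Set (EuclideanSpace ℝ (Fin d))} {f : EuclideanSpace ℝ (Fin d) → E}
    (hf : IsLocalParam d S U f) {u : EuclideanSpace ℝ (Fin d)} (hu : u ∈ U)
    (σ : E →ₗᵢ[ℝ] E) (c : E) (hS : ∀ p ∈ S, σ p + c ∈ S) (hfix : σ (f u) + c = f u) :
    σ (meanCurvatureVector f u) = meanCurvatureVector f u := by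
  set τ : E ≃ₗᵢ[ℝ] E := σ.toLinearIsometryEquiv rfl with hτ
  have hτσ : ∀ v, τ v = σ v := fun v => rfl
  have hfu := hf.contDiffAt hu
  have hc : ContDiffAt ℝ ∞ (fun y => σ (f y) + c) u :=
    (σ.toContinuousLinearMap.contDiff.contDiffAt.comp u hfu).add contDiffAt_const
  have hfS : ∀ᶠ y in 𝓝 u, f y ∈ S := by
    obtain ⟨V, -, hfV⟩ := hf.image
    filter_upwards [hf.isOpen.mem_nhds hu] with y hy
    exact (hfV.subset ⟨y, hy, rfl⟩).1
  -- The moved parametrization again maps into S and is thus f ∘ φ with `φ u = u`. Its mean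
  -- curvature is H by reparametrization and σ H by isometry.
  obtain ⟨φ, hφ, hφu, hcφ⟩ := hf.exists_lift hu hc hfix (hfS.mono fun y hy => hS _ hy)
  have himm : Function.Injective (fderiv ℝ (fun y => σ (f y) + c) u) := by
    have h1 := ((σ.toContinuousLinearMap.hasFDerivAt.comp u
      (hfu.differentiableAt (by simp)).hasFDerivAt).add_const c).fderiv
    have h2 : fderiv ℝ (fun y => σ (f y) + c) u =
      σ.toContinuousLinearMap.comp (fderiv ℝ f u) := h1
    rw [h2]
    exact σ.injective.comp (hf.immersion u hu)
  have h1 := meanCurvatureVector_comp (by rwa [hφu]) hφ hcφ himm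
  have h2 := meanCurvatureVector_isometry_comp τ c hfu
  simp only [hτσ] at h2
  rw [← h2, h1, hφu]

end MeanCurvature

/-! ### Real and imaginary parts, the cone |x| = |y| and the conjugate-linear swap -/

section ComplexVectors

variable {ι : Type*}

/-- The vector `x + i y` of `ℂ^ι`. -/
noncomputable def complexVec (x y : EuclideanSpace ℝ ι) : EuclideanSpace ℂ ι :=
  WithLp.toLp 2 fun k => (x k : ℂ) + Complex.I * (y k : ℂ)

/-- The real part of a complex vector. -/
noncomputable def reVec : EuclideanSpace ℂ ι →ₗ[ℝ] EuclideanSpace ℝ ι where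
  toFun Q := WithLp.toLp 2 fun k => (Q k).re
  map_add' _ _ := by ext; simp
  map_smul' _ _ := by ext; simp

/-- The imaginary part of a complex vector. -/
noncomputable def imVec : EuclideanSpace ℂ ι →ₗ[ℝ] EuclideanSpace ℝ ι where
  toFun Q := WithLp.toLp 2 fun k => (Q k).im
  map_add' _ _ := by ext; simp
  map_smul' _ _ := by ext; simp

@[simp] theorem complexVec_apply (x y : EuclideanSpace ℝ ι) (k : ι) :
    complexVec x y k = (x k : ℂ) + Complex.I * (y k : ℂ) := rfl

@[simp] theorem reVec_apply (Q : EuclideanSpace ℂ ι) (k : ι) : reVec Q k = (Q k).re := rfl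

@[simp] theorem imVec_apply (Q : EuclideanSpace ℂ ι) (k : ι) : imVec Q k = (Q k).im := rfl

@[simp] theorem reVec_complexVec (x y : EuclideanSpace ℝ ι) : reVec (complexVec x y) = x := by
  ext; simp

@[simp] theorem imVec_complexVec (x y : EuclideanSpace ℝ ι) : imVec (complexVec x y) = y := by
  ext; simp

@[simp] theorem complexVec_reVec_imVec (Q : EuclideanSpace ℂ ι) :
    complexVec (reVec Q) (imVec Q) = Q := by
  ext k; simp [mul_comm Complex.I]

theorem complexVec_ext {Q Q' : EuclideanSpace ℂ ι} (h1 : reVec Q = reVec Q')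
    (h2 : imVec Q = imVec Q') : Q = Q' := by
  rw [← complexVec_reVec_imVec Q, h1, h2, complexVec_reVec_imVec]

variable [Fintype ι]

theorem real_inner_eq_reVec_imVec (Q Q' : EuclideanSpace ℂ ι) :
    inner ℝ Q Q' = inner ℝ (reVec Q) (reVec Q') + inner ℝ (imVec Q) (imVec Q') := by
  simp only [PiLp.inner_apply, reVec_apply, imVec_apply, ← Finset.sum_add_distrib]
  refine Finset.sum_congr rfl fun k _ => ?_
  simp [Complex.inner, mul_comm]

theorem real_inner_smul_smul_of_norm_one {w : ℂ} (hw : ‖w‖ = 1) (Q Q' : EuclideanSpace ℂ ι) :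
    inner ℝ (w • Q) (w • Q') = inner ℝ Q Q' := by
  have h : w.re * w.re + w.im * w.im = 1 := by
    rw [← Complex.normSq_apply, Complex.normSq_eq_norm_sq, hw]; norm_num
  simp only [PiLp.inner_apply, PiLp.smul_apply, Complex.inner, smul_eq_mul, map_mul]
  refine Finset.sum_congr rfl fun k _ => ?_
  simp
  linear_combination ((Q k).re * (Q' k).re + (Q k).im * (Q' k).im) * h

/-- The cone `|x| = |y|` of all `x + i y`; it is the real cone over the Clifford torus. -/
def cliffordCone (ι : Type*) [Fintype ι] : Set (EuclideanSpace ℂ ι) :=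
  {Q | ‖reVec Q‖ = ‖imVec Q‖}

theorem smul_mem_cliffordCone (a : ℝ) {Q : EuclideanSpace ℂ ι} (hQ : Q ∈ cliffordCone ι) :
    a • Q ∈ cliffordCone ι := by
  simp only [cliffordCone, Set.mem_ofPred_eq, map_smul, norm_smul] at hQ ⊢
  rw [hQ]

/-- The conjugate-linear map `x + i y ↦ A y + i A x`. -/
noncomputable def conjSwap (A : EuclideanSpace ℝ ι →ₗᵢ[ℝ] EuclideanSpace ℝ ι)
    (Q : EuclideanSpace ℂ ι) : EuclideanSpace ℂ ι :=
  complexVec (A (imVec Q)) (A (reVec Q))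

theorem conjSwap_mem_cliffordCone (A : EuclideanSpace ℝ ι →ₗᵢ[ℝ] EuclideanSpace ℝ ι)
    {Q : EuclideanSpace ℂ ι} (hQ : Q ∈ cliffordCone ι) : conjSwap A Q ∈ cliffordCone ι := by
  simp only [cliffordCone, Set.mem_ofPred_eq] at hQ ⊢
  simp [conjSwap, hQ]

theorem conjSwap_add (A : EuclideanSpace ℝ ι →ₗᵢ[ℝ] EuclideanSpace ℝ ι)
    (Q Q' : EuclideanSpace ℂ ι) : conjSwap A (Q + Q') = conjSwap A Q + conjSwap A Q' :=
  complexVec_ext (by simp [conjSwap]) (by simp [conjSwap])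

theorem conjSwap_real_smul (A : EuclideanSpace ℝ ι →ₗᵢ[ℝ] EuclideanSpace ℝ ι) (a : ℝ)
    (Q : EuclideanSpace ℂ ι) : conjSwap A (a • Q) = a • conjSwap A Q :=
  complexVec_ext (by simp [conjSwap]) (by simp [conjSwap])

/-- The swap is Q ↦ i A(Q̄), hence conjugate-linear. This is what lets it reverse the sense of the
screw rotation. -/
theorem conjSwap_smul (A : EuclideanSpace ℝ ι →ₗᵢ[ℝ] EuclideanSpace ℝ ι) (w : ℂ)
    (Q : EuclideanSpace ℂ ι) : conjSwap A (w • Q) = (starRingEnd ℂ w) • conjSwap A Q := by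
  have h1 : imVec (w • Q) = w.re • imVec Q + w.im • reVec Q := by ext; simp
  have h2 : reVec (w • Q) = w.re • reVec Q - w.im • imVec Q := by ext; simp
  refine complexVec_ext ?_ ?_
  · rw [conjSwap, reVec_complexVec, h1]
    ext k; simp [conjSwap]
  · rw [conjSwap, imVec_complexVec, h2]
    ext k; simp [conjSwap]; ring

end ComplexVectors

/-! ### The vectors r ⊗ Q and the isometries acting on them -/

section Rays

variable {ι κ : Type*}

/-- The vector `(r_1 Q, …, r_L Q)`. -/
noncomputable def raysVec (r : EuclideanSpace ℝ ι) :
    EuclideanSpace ℂ κ →ₗ[ℂ] EuclideanSpace ℂ (ι × κ) where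
  toFun Q := WithLp.toLp 2 fun sk => (r sk.1 : ℂ) * Q sk.2
  map_add' _ _ := by ext; simp [mul_add]
  map_smul' _ _ := by ext; simp; ring

@[simp] theorem raysVec_apply (r : EuclideanSpace ℝ ι) (Q : EuclideanSpace ℂ κ) (sk : ι × κ) :
    raysVec r Q sk = (r sk.1 : ℂ) * Q sk.2 := rfl

theorem raysVec_add (r r' : EuclideanSpace ℝ ι) (Q : EuclideanSpace ℂ κ) :
    raysVec (r + r') Q = raysVec r Q + raysVec r' Q := by
  ext; simp [add_mul]

theorem raysVec_smul (a : ℝ) (r : EuclideanSpace ℝ ι) (Q : EuclideanSpace ℂ κ) :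
    raysVec (a • r) Q = a • raysVec r Q := by
  ext; simp [mul_assoc]

theorem raysVec_smul_right (a : ℝ) (r : EuclideanSpace ℝ ι) (Q : EuclideanSpace ℂ κ) :
    raysVec r (a • Q) = a • raysVec r Q := by
  ext; simp

theorem raysVec_zero (Q : EuclideanSpace ℂ κ) :
    raysVec (0 : EuclideanSpace ℝ ι) Q = 0 := by
  ext; simp

theorem raysVec_injective {r : EuclideanSpace ℝ ι} (hr : r ≠ 0) :
    Function.Injective (raysVec r : EuclideanSpace ℂ κ → EuclideanSpace ℂ (ι × κ)) := by
  intro Q Q' h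
  obtain ⟨s, hs⟩ : ∃ s, r s ≠ 0 := by
    by_contra! h0
    exact hr (by ext s; simp [h0])
  ext k
  have := congrArg (fun Z : EuclideanSpace ℂ (ι × κ) => Z (s, k)) h
  simpa [hs] using this

variable [Fintype ι] [Fintype κ]

theorem inner_raysVec (r r' : EuclideanSpace ℝ ι) (Q Q' : EuclideanSpace ℂ κ) :
    inner ℝ (raysVec r Q) (raysVec r' Q') = inner ℝ r r' * inner ℝ Q Q' := by
  simp only [PiLp.inner_apply, raysVec_apply, Fintype.sum_prod_type, Finset.sum_mul_sum]
  refine Finset.sum_congr rfl fun s _ => Finset.sum_congr rfl fun k _ => ?_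
  simp [Complex.inner]; ring

/-- The real scale of Q can be absorbed into r, so the torus may be replaced by the full cone over
it, which is closed under real scaling. -/
theorem mem_raysCone_cliffordTorus {L N : ℕ} {Z : EuclideanSpace ℂ (Fin L × Fin (N + 1))} :
    Z ∈ raysCone L (cliffordTorus N) ↔
      ∃ r : EuclideanSpace ℝ (Fin L), ∃ Q ∈ cliffordCone (Fin (N + 1)), Z = raysVec r Q := by
  constructor
  · rintro ⟨r, P, ⟨X, Y, hX, hY, hP⟩, hZ⟩
    refine ⟨WithLp.toLp 2 r, P, ?_, by ext ⟨s, k⟩; simp [hZ]⟩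
    have : P = (1 / √2 : ℝ) • complexVec X Y := by ext k; simp [hP, mul_add]
    rw [this]
    apply smul_mem_cliffordCone
    simp [cliffordCone, hX, hY]
  · rintro ⟨r, Q, hQ, rfl⟩
    by_cases h0 : reVec Q = 0
    · have h1 : imVec Q = 0 := by
        have : ‖reVec Q‖ = ‖imVec Q‖ := hQ
        rwa [h0, norm_zero, eq_comm, norm_eq_zero] at this
      -- Here Z = 0: zero coefficients with an arbitrary torus point.
      have h2 : Q = 0 := complexVec_ext (by simp [h0]) (by simp [h1])
      refine ⟨0, complexVec ((1 / √2 : ℝ) • EuclideanSpace.single 0 1)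
        ((1 / √2 : ℝ) • EuclideanSpace.single 0 1),
        ⟨EuclideanSpace.single 0 1, EuclideanSpace.single 0 1, by simp, by simp, fun k => ?_⟩, ?_⟩
      · simp only [complexVec_apply, PiLp.smul_apply, smul_eq_mul]
        push_cast; ring
      · intro s k; simp [h2]
    · have hn : ‖reVec Q‖ ≠ 0 := norm_ne_zero_iff.2 h0
      have hn' : ‖imVec Q‖ = ‖reVec Q‖ := Eq.symm hQ
      -- On the cone ‖Q‖ = √2 ‖x‖, so this normalizes Q to the torus and moves its length into r.
      refine ⟨fun s => √2 * ‖reVec Q‖ * r s, (1 / (√2 * ‖reVec Q‖)) • Q,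
        ⟨‖reVec Q‖⁻¹ • reVec Q, ‖reVec Q‖⁻¹ • imVec Q, ?_, ?_, fun k => ?_⟩, fun s k => ?_⟩
      · simp [norm_smul, hn]
      · simp [norm_smul, hn, hn']
      · have hk : Q k = ((reVec Q k : ℝ) : ℂ) + Complex.I * ((imVec Q k : ℝ) : ℂ) :=
          (congrArg (fun V : EuclideanSpace ℂ (Fin (N + 1)) => V k)
            (complexVec_reVec_imVec Q)).symm
        rw [PiLp.smul_apply, hk]
        simp only [PiLp.smul_apply, Complex.real_smul, smul_eq_mul]
        push_cast; field_simp
      · have h2 : ((√2 : ℝ) : ℂ) ≠ 0 := by simp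
        have h3 : ((‖reVec Q‖ : ℝ) : ℂ) ≠ 0 := by exact_mod_cast hn
        simp
        field_simp

/-- Blockwise `conjSwap`, multiplied by a phase. -/
noncomputable def blockConjSwap (w : ℂ) (hw : ‖w‖ = 1)
    (A : EuclideanSpace ℝ κ →ₗᵢ[ℝ] EuclideanSpace ℝ κ) :
    EuclideanSpace ℂ (ι × κ) →ₗᵢ[ℝ] EuclideanSpace ℂ (ι × κ) where
  toFun Z := WithLp.toLp 2 fun sk => w * conjSwap A (WithLp.toLp 2 fun k => Z (sk.1, k)) sk.2
  map_add' Z Z' := by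
    ext ⟨s, k⟩
    have h := congrArg (fun V : EuclideanSpace ℂ κ => w * V k)
      (conjSwap_add A (WithLp.toLp 2 fun k => Z (s, k)) (WithLp.toLp 2 fun k => Z' (s, k)))
    exact h.trans (mul_add _ _ _)
  map_smul' a Z := by
    ext ⟨s, k⟩
    have h := congrArg (fun V : EuclideanSpace ℂ κ => w * V k)
      (conjSwap_real_smul A a (WithLp.toLp 2 fun k => Z (s, k)))
    refine h.trans ?_
    simp only [PiLp.smul_apply, mul_smul_comm, RingHom.id_apply]
  norm_map' Z := by
    have key : ∀ Q : EuclideanSpace ℂ κ, ∑ k, ‖w * conjSwap A Q k‖ ^ 2 = ∑ k, ‖Q k‖ ^ 2 := by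
      intro Q
      have h1 : ∀ Q : EuclideanSpace ℂ κ, ∑ k, ‖Q k‖ ^ 2 = ‖reVec Q‖ ^ 2 + ‖imVec Q‖ ^ 2 := by
        intro Q
        rw [← EuclideanSpace.norm_sq_eq, ← real_inner_self_eq_norm_sq, real_inner_eq_reVec_imVec,
          real_inner_self_eq_norm_sq, real_inner_self_eq_norm_sq]
      simp only [norm_mul, hw, one_mul]
      rw [h1, h1, conjSwap, reVec_complexVec, imVec_complexVec, A.norm_map, A.norm_map, add_comm]
    rw [← sq_eq_sq₀ (norm_nonneg _) (norm_nonneg _), EuclideanSpace.norm_sq_eq,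
      EuclideanSpace.norm_sq_eq, Fintype.sum_prod_type, Fintype.sum_prod_type]
    exact Finset.sum_congr rfl fun s _ => key (WithLp.toLp 2 fun k => Z (s, k))

/-- The coefficients of r are real, so the conjugate-linear swap passes through them. -/
theorem blockConjSwap_raysVec (w : ℂ) (hw : ‖w‖ = 1)
    (A : EuclideanSpace ℝ κ →ₗᵢ[ℝ] EuclideanSpace ℝ κ) (r : EuclideanSpace ℝ ι)
    (Q : EuclideanSpace ℂ κ) :
    blockConjSwap w hw A (raysVec r Q) = w • raysVec r (conjSwap A Q) := by
  ext ⟨s, k⟩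
  have h1 : (WithLp.toLp 2 fun k => raysVec r Q (s, k) : EuclideanSpace ℂ κ) =
    ((r s : ℝ) : ℂ) • Q := rfl
  change w * conjSwap A (WithLp.toLp 2 fun k => raysVec r Q (s, k)) k = _
  rw [h1, conjSwap_smul]
  simp

/-- The reflection of `ℂ^{ι × κ} = ℝ^ι ⊗ ℂ^κ` in `r ⊗ ℂ^κ`. -/
noncomputable def rayReflection (κ : Type*) [Fintype κ] (r : EuclideanSpace ℝ ι) :
    EuclideanSpace ℂ (ι × κ) ≃ₗᵢ[ℝ] EuclideanSpace ℂ (ι × κ) :=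
  (LinearMap.range ((raysVec r : EuclideanSpace ℂ κ →ₗ[ℂ] _).restrictScalars ℝ)).reflection

/-- Split r' along r and its complement: by `inner_raysVec` the reflection fixes the first part
tensor Q and negates the second. Since Q is untouched, rays over any cone are preserved. -/
theorem rayReflection_raysVec {r : EuclideanSpace ℝ ι} (hr : r ≠ 0) (r' : EuclideanSpace ℝ ι)
    (Q : EuclideanSpace ℂ κ) :
    rayReflection κ r (raysVec r' Q) =
      raysVec ((2 * (inner ℝ r r' / ‖r‖ ^ 2)) • r - r') Q := by
  set a := inner ℝ r r' / ‖r‖ ^ 2 with ha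
  have hr2 : ‖r‖ ^ 2 ≠ 0 := pow_ne_zero _ (norm_ne_zero_iff.2 hr)
  have h1 : r' = a • r + (r' - a • r) := by abel
  have hb : inner ℝ r (r' - a • r) = 0 := by
    rw [inner_sub_right, real_inner_smul_right, real_inner_self_eq_norm_sq, ha]
    field_simp; ring
  have h2 : rayReflection κ r (raysVec (a • r) Q) = raysVec (a • r) Q := by
    refine Submodule.reflection_mem_subspace_eq_self ⟨a • Q, ?_⟩
    change raysVec r (a • Q) = _
    rw [raysVec_smul, raysVec_smul_right]
  have h3 : rayReflection κ r (raysVec (r' - a • r) Q) = -raysVec (r' - a • r) Q := by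
    refine Submodule.reflection_mem_subspace_orthogonalComplement_eq_neg ?_
    rintro _ ⟨v, rfl⟩
    change inner ℝ (raysVec r v) _ = 0
    rw [inner_raysVec, hb, zero_mul]
  have h4 : (2 * a) • r - r' = a • r + (-1 : ℝ) • (r' - a • r) := by module
  rw [h4]
  conv_lhs => rw [h1]
  rw [raysVec_add, map_add, h2, h3, raysVec_add, raysVec_smul (-1)]
  simp

theorem exists_raysVec_of_rayReflection_eq {r : EuclideanSpace ℝ ι} {Z : EuclideanSpace ℂ (ι × κ)}
    (h : rayReflection κ r Z = Z) : ∃ v, Z = raysVec r v := by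
  obtain ⟨v, hv⟩ := (Submodule.reflection_eq_self_iff Z).1 h
  exact ⟨v, hv.symm⟩

end Rays

/-! ### Normal form of points of the helicoid; product isometries -/

section Helicoid

open Filter Topology

variable {L N : ℕ}

theorem mem_generalizedHelicoid {lam lam₀ : ℝ} {p : HelicoidSpace L N} :
    p ∈ generalizedHelicoid lam lam₀ L N ↔ ∃ Θ : ℝ, ∃ r : EuclideanSpace ℝ (Fin L),
      ∃ Q ∈ cliffordCone (Fin (N + 1)), p = WithLp.toLp 2
        (Complex.exp (Complex.I * ((lam * Θ : ℝ) : ℂ)) • raysVec r Q, lam₀ * Θ) := by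
  constructor
  · rintro ⟨Θ, Z, hZ, hp⟩
    obtain ⟨r, Q, hQ, rfl⟩ := mem_raysCone_cliffordTorus.1 hZ
    exact ⟨Θ, r, Q, hQ, hp⟩
  · rintro ⟨Θ, r, Q, hQ, hp⟩
    exact ⟨Θ, _, mem_raysCone_cliffordTorus.2 ⟨r, Q, hQ, rfl⟩, hp⟩

/-- The product of a linear isometry of `ℂ^{L(N+1)}` and `z ↦ ε z`, for a sign `ε`. -/
noncomputable def prodSign (T : EuclideanSpace ℂ (Fin L × Fin (N + 1)) →ₗᵢ[ℝ]
    EuclideanSpace ℂ (Fin L × Fin (N + 1))) (ε : ℝ) (hε : |ε| = 1) :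
    HelicoidSpace L N →ₗᵢ[ℝ] HelicoidSpace L N where
  toFun p := WithLp.toLp 2 (T p.fst, ε * p.snd)
  map_add' p q := by
    simp [mul_add, ← WithLp.toLp_add]
  map_smul' a p := by
    simp [mul_left_comm, ← WithLp.toLp_smul]
  norm_map' p := by
    have h : ‖ε‖ = 1 := hε
    rw [← sq_eq_sq₀ (norm_nonneg _) (norm_nonneg _), WithLp.prod_norm_sq_eq_of_L2,
      WithLp.prod_norm_sq_eq_of_L2]
    change ‖T p.fst‖ ^ 2 + ‖ε * p.snd‖ ^ 2 = _
    rw [T.norm_map, norm_mul, h, one_mul]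

theorem prodSign_apply (T : EuclideanSpace ℂ (Fin L × Fin (N + 1)) →ₗᵢ[ℝ]
    EuclideanSpace ℂ (Fin L × Fin (N + 1))) (ε : ℝ) (hε : |ε| = 1) (p : HelicoidSpace L N) :
    prodSign T ε hε p = WithLp.toLp 2 (T p.fst, ε * p.snd) := rfl

end Helicoid

/-! ### Symmetries of the helicoid and what they force on its mean curvature -/

section HelicoidMeanCurvature

open Filter Topology

variable {L N : ℕ}

/-- The unit complex number `e^{iα}`. -/
noncomputable def phase (α : ℝ) : ℂ := Complex.exp (Complex.I * (α : ℂ))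

theorem norm_phase (α : ℝ) : ‖phase α‖ = 1 := by
  rw [phase, mul_comm, Complex.norm_exp_ofReal_mul_I]

theorem phase_ne_zero (α : ℝ) : phase α ≠ 0 := Complex.exp_ne_zero _

theorem phase_add (α β : ℝ) : phase (α + β) = phase α * phase β := by
  rw [phase, phase, phase, ← Complex.exp_add]; push_cast; ring_nf

theorem conj_phase (α : ℝ) : starRingEnd ℂ (phase α) = phase (-α) := by
  rw [phase, phase, ← Complex.exp_conj]; simp

theorem phase_zero : phase 0 = 1 := by simp [phase]

/-- The point of the generalized helicoid with screw parameter `Θ`, ray coefficients `r` and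
direction `Q`. -/
noncomputable def helicoidPoint (lam lam₀ Θ : ℝ) (r : EuclideanSpace ℝ (Fin L))
    (Q : EuclideanSpace ℂ (Fin (N + 1))) : HelicoidSpace L N :=
  WithLp.toLp 2 (phase (lam * Θ) • raysVec r Q, lam₀ * Θ)

theorem mem_generalizedHelicoid_iff {lam lam₀ : ℝ} {p : HelicoidSpace L N} :
    p ∈ generalizedHelicoid lam lam₀ L N ↔ ∃ Θ : ℝ, ∃ r : EuclideanSpace ℝ (Fin L),
      ∃ Q ∈ cliffordCone (Fin (N + 1)), p = helicoidPoint lam lam₀ Θ r Q :=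
  mem_generalizedHelicoid

theorem helicoidPoint_mem (lam lam₀ Θ : ℝ) (r : EuclideanSpace ℝ (Fin L))
    {Q : EuclideanSpace ℂ (Fin (N + 1))} (hQ : Q ∈ cliffordCone (Fin (N + 1))) :
    helicoidPoint lam lam₀ Θ r Q ∈ generalizedHelicoid lam lam₀ L N :=
  mem_generalizedHelicoid_iff.2 ⟨Θ, r, Q, hQ, rfl⟩

/-- The linear part of the symmetry of the helicoid that reverses the axis about the level `Θ₀`. -/
noncomputable def screwFlip (lam Θ₀ : ℝ)
    (A : EuclideanSpace ℝ (Fin (N + 1)) →ₗᵢ[ℝ] EuclideanSpace ℝ (Fin (N + 1))) :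
    HelicoidSpace L N →ₗᵢ[ℝ] HelicoidSpace L N :=
  prodSign (blockConjSwap (phase (lam * (2 * Θ₀))) (norm_phase _) A) (-1) (by simp)

/-- Conjugation turns the phase λΘ into -λΘ and the prefactor adds 2λΘ₀, matching the reflection Θ ↦
2Θ₀ - Θ of the axis. -/
theorem screwFlip_helicoidPoint (lam lam₀ Θ₀ Θ : ℝ)
    (A : EuclideanSpace ℝ (Fin (N + 1)) →ₗᵢ[ℝ] EuclideanSpace ℝ (Fin (N + 1)))
    (r : EuclideanSpace ℝ (Fin L)) (Q : EuclideanSpace ℂ (Fin (N + 1))) :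
    screwFlip lam Θ₀ A (helicoidPoint lam lam₀ Θ r Q) + WithLp.toLp 2 (0, lam₀ * (2 * Θ₀)) =
      helicoidPoint lam lam₀ (2 * Θ₀ - Θ) r (conjSwap A Q) := by
  rw [screwFlip, prodSign_apply, helicoidPoint, helicoidPoint]
  rw [← WithLp.toLp_add]
  simp only [Prod.mk_add_mk, add_zero]
  congr 2
  · change blockConjSwap _ _ A (phase (lam * Θ) • raysVec r Q) = _
    rw [← map_smul, blockConjSwap_raysVec, conjSwap_smul, conj_phase, map_smul, smul_smul,
      ← phase_add]
    ring_nf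
  · change -1 * (lam₀ * Θ) + lam₀ * (2 * Θ₀) = _
    ring

/-- The linear symmetry of the helicoid reflecting the ray coefficients in the line of `r`. -/
noncomputable def rayFlip (r : EuclideanSpace ℝ (Fin L)) :
    HelicoidSpace L N →ₗᵢ[ℝ] HelicoidSpace L N :=
  prodSign (rayReflection (Fin (N + 1)) r).toLinearIsometry 1 (by simp)

theorem rayFlip_helicoidPoint (lam lam₀ Θ : ℝ) {r : EuclideanSpace ℝ (Fin L)} (hr : r ≠ 0)
    (r' : EuclideanSpace ℝ (Fin L)) (Q : EuclideanSpace ℂ (Fin (N + 1))) :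
    rayFlip r (helicoidPoint lam lam₀ Θ r' Q) =
      helicoidPoint lam lam₀ Θ ((2 * (inner ℝ r r' / ‖r‖ ^ 2)) • r - r') Q := by
  rw [rayFlip, prodSign_apply, helicoidPoint, helicoidPoint]
  congr 2
  · change rayReflection (Fin (N + 1)) r (phase (lam * Θ) • raysVec r' Q) = _
    rw [← map_smul, rayReflection_raysVec hr, map_smul]
  · simp

variable {lam lam₀ : ℝ} {d : ℕ} {U : Set (EuclideanSpace ℝ (Fin d))}
  {f : EuclideanSpace ℝ (Fin d) → HelicoidSpace L N} {u : EuclideanSpace ℝ (Fin d)}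

theorem screwFlip_meanCurvatureVector (hf : IsLocalParam d (generalizedHelicoid lam lam₀ L N) U f)
    (hu : u ∈ U) {Θ : ℝ} {r : EuclideanSpace ℝ (Fin L)} {Q : EuclideanSpace ℂ (Fin (N + 1))}
    (hp : f u = helicoidPoint lam lam₀ Θ r Q)
    (A : EuclideanSpace ℝ (Fin (N + 1)) →ₗᵢ[ℝ] EuclideanSpace ℝ (Fin (N + 1)))
    (hA : conjSwap A Q = Q) :
    screwFlip lam Θ A (meanCurvatureVector f u) = meanCurvatureVector f u := by
  refine hf.map_meanCurvatureVector hu _ (WithLp.toLp 2 (0, lam₀ * (2 * Θ))) ?_ ?_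
  · intro p hp
    obtain ⟨Θ', r', Q', hQ', rfl⟩ := mem_generalizedHelicoid_iff.1 hp
    rw [screwFlip_helicoidPoint]
    exact helicoidPoint_mem _ _ _ _ (conjSwap_mem_cliffordCone A hQ')
  · rw [hp, screwFlip_helicoidPoint, hA]
    congr 1; ring

theorem snd_eq_zero_of_screwFlip {Θ : ℝ}
    {A : EuclideanSpace ℝ (Fin (N + 1)) →ₗᵢ[ℝ] EuclideanSpace ℝ (Fin (N + 1))}
    {m : HelicoidSpace L N} (h : screwFlip lam Θ A m = m) : m.snd = 0 := by
  have h1 : -1 * m.snd = m.snd := congrArg (fun q : HelicoidSpace L N => q.snd) h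
  linarith

theorem rayFlip_meanCurvatureVector (hf : IsLocalParam d (generalizedHelicoid lam lam₀ L N) U f)
    (hu : u ∈ U) {Θ : ℝ} {r : EuclideanSpace ℝ (Fin L)} (hr : r ≠ 0)
    {Q : EuclideanSpace ℂ (Fin (N + 1))} (hp : f u = helicoidPoint lam lam₀ Θ r Q) :
    rayFlip r (meanCurvatureVector f u) = meanCurvatureVector f u := by
  have hr2 : ‖r‖ ^ 2 ≠ 0 := pow_ne_zero _ (norm_ne_zero_iff.2 hr)
  refine hf.map_meanCurvatureVector hu _ 0 ?_ ?_
  · intro p hp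
    obtain ⟨Θ', r', Q', hQ', rfl⟩ := mem_generalizedHelicoid_iff.1 hp
    rw [rayFlip_helicoidPoint _ _ _ hr, add_zero]
    exact helicoidPoint_mem _ _ _ _ hQ'
  · rw [hp, rayFlip_helicoidPoint _ _ _ hr, add_zero, real_inner_self_eq_norm_sq, div_self hr2]
    congr 1; module

/-- The mean curvature vector vanishes at regular points on the axis. -/
theorem meanCurvatureVector_eq_zero_of_axis
    (hf : IsLocalParam d (generalizedHelicoid lam lam₀ L N) U f) (hu : u ∈ U) {Θ : ℝ}
    (hp : f u = helicoidPoint lam lam₀ Θ 0 0) : meanCurvatureVector f u = 0 := by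
  -- With Q = 0 every A is admissible; the identity is enough.
  have h1 := snd_eq_zero_of_screwFlip (screwFlip_meanCurvatureVector hf hu hp LinearIsometry.id
    (by simpa using conjSwap_real_smul LinearIsometry.id 0 (0 : EuclideanSpace ℂ (Fin (N + 1)))))
  -- The symmetry Z ↦ -Z, that is r ↦ -r, fixes the axis pointwise and kills the remaining
  -- component.
  have h2 := hf.map_meanCurvatureVector hu
    (prodSign (LinearIsometryEquiv.neg ℝ).toLinearIsometry 1 (by simp)) 0 (by
      intro p hp
      obtain ⟨Θ', r', Q', hQ', rfl⟩ := mem_generalizedHelicoid_iff.1 hp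
      have : prodSign (LinearIsometryEquiv.neg ℝ).toLinearIsometry 1 (by simp)
        (helicoidPoint lam lam₀ Θ' r' Q') + 0 = helicoidPoint lam lam₀ Θ' ((-1 : ℝ) • r') Q' := by
        rw [prodSign_apply, helicoidPoint, helicoidPoint, raysVec_smul]
        simp
      rw [this]
      exact helicoidPoint_mem _ _ _ _ hQ') (by
      rw [hp, prodSign_apply, helicoidPoint]
      simp)
  have h3 : -(meanCurvatureVector f u).fst = (meanCurvatureVector f u).fst :=
    congrArg (fun q : HelicoidSpace L N => q.fst) h2
  have h4 : (meanCurvatureVector f u).fst = 0 := by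
    have h5 : (2 : ℝ) • (meanCurvatureVector f u).fst = 0 := by
      rw [two_smul]
      nth_rewrite 1 [← h3]
      exact neg_add_cancel _
    exact (smul_eq_zero.1 h5).resolve_left two_ne_zero
  refine WithLp.ofLp_injective 2 (Prod.ext h4 h1)

/-- Normality descends to the cone: moving Q alone, with r and Θ fixed, gives a curve in the
helicoid whose velocity has inner product ‖r‖² ⟨q', v⟩ with H. -/
theorem inner_helicoid_velocity (hf : IsLocalParam d (generalizedHelicoid lam lam₀ L N) U f)
    (hu : u ∈ U) {Θ : ℝ} {r : EuclideanSpace ℝ (Fin L)} (hr : r ≠ 0)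
    {Q v : EuclideanSpace ℂ (Fin (N + 1))}
    (hp : f u = helicoidPoint lam lam₀ Θ r Q)
    (hm : (meanCurvatureVector f u).fst = phase (lam * Θ) • raysVec r v)
    {q : ℝ → EuclideanSpace ℂ (Fin (N + 1))} (hq : ContDiffAt ℝ ∞ q 0) (hq0 : q 0 = Q)
    (hqK : ∀ t, q t ∈ cliffordCone (Fin (N + 1))) {q' : EuclideanSpace ℂ (Fin (N + 1))}
    (hq' : HasDerivAt q q' 0) : inner ℝ q' v = 0 := by
  set G : EuclideanSpace ℂ (Fin (N + 1)) →L[ℝ] HelicoidSpace L N := LinearMap.toContinuousLinearMap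
    { toFun := fun q => WithLp.toLp 2 (phase (lam * Θ) • raysVec r q, 0)
      map_add' := fun a b => by simp [← WithLp.toLp_add]
      map_smul' := fun a b => by
        rw [raysVec_smul_right, smul_comm]
        simp [← WithLp.toLp_smul] } with hG
  have hGq : ∀ q, G q = WithLp.toLp 2 (phase (lam * Θ) • raysVec r q, 0) := fun q => rfl
  have hc : ∀ t, G (q t) + WithLp.toLp 2 (0, lam₀ * Θ) = helicoidPoint lam lam₀ Θ r (q t) := by
    intro t
    rw [hGq, helicoidPoint, ← WithLp.toLp_add]
    simp
  have key := hf.inner_meanCurvatureVector_eq_zero hu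
    (c := fun t => G (q t) + WithLp.toLp 2 (0, lam₀ * Θ))
    ((G.contDiff.contDiffAt.comp 0 hq).add contDiffAt_const) (by rw [hc, hq0, hp])
    (Eventually.of_forall fun t => by rw [hc]; exact helicoidPoint_mem _ _ _ _ (hqK t))
    ((G.hasFDerivAt.comp_hasDerivAt 0 hq').add_const _)
  rw [hGq, WithLp.prod_inner_apply] at key
  have h1 : (WithLp.ofLp (meanCurvatureVector f u)).1 = phase (lam * Θ) • raysVec r v := hm
  rw [h1] at key
  simp only [inner_zero_left, add_zero] at key
  rw [real_inner_smul_smul_of_norm_one (norm_phase _), inner_raysVec] at key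
  rcases mul_eq_zero.1 key with h | h
  · exact absurd (inner_self_eq_zero.1 h) hr
  · exact h

end HelicoidMeanCurvature

/-! ### Tangent and normal directions of the cone |x| = |y| -/

section ConeTangent

variable {ι : Type*} [Fintype ι]

/-- Tangent directions of the cone `|x| = |y|` at a nonzero point, realized by smooth curves. -/
theorem exists_curve_cliffordCone {x y x' y' : EuclideanSpace ℝ ι} (hx : x ≠ 0) (hxy : ‖x‖ = ‖y‖)
    (hx' : inner ℝ x x' = 0) (hy' : inner ℝ y y' = 0) :
    ∃ q : ℝ → EuclideanSpace ℂ ι, ContDiffAt ℝ ∞ q 0 ∧ q 0 = complexVec x y ∧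
      (∀ t, q t ∈ cliffordCone ι) ∧ HasDerivAt q (complexVec x' y') 0 := by
  have hn : ‖x‖ ≠ 0 := norm_ne_zero_iff.2 hx
  have hsq : ∀ a : ℝ, ContDiff ℝ ∞ (fun t : ℝ => √(1 + a ^ 2 * t ^ 2)) := by
    intro a
    refine ContDiff.sqrt (by fun_prop) fun t => ?_
    positivity
  have hsd : ∀ a : ℝ, HasDerivAt (fun t : ℝ => √(1 + a ^ 2 * t ^ 2)) 0 0 := by
    intro a
    have h1 : HasDerivAt (fun t : ℝ => 1 + a ^ 2 * t ^ 2) 0 0 := by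
      have := ((hasDerivAt_pow 2 (0 : ℝ)).const_mul (a ^ 2)).const_add 1
      simpa using this
    simpa using h1.sqrt (by norm_num)
  -- With these constants both parts have squared norm ‖x‖² + t²(‖x'‖² + ‖y'‖²), and the square
  -- roots have zero derivative at t = 0, so the velocity is unaffected.
  set a := ‖y'‖ / ‖x‖ with ha
  set b := ‖x'‖ / ‖x‖ with hb
  refine ⟨fun t => √(1 + a ^ 2 * t ^ 2) • complexVec x 0 + √(1 + b ^ 2 * t ^ 2) • complexVec 0 y +
    t • complexVec x' y', ?_, ?_, ?_, ?_⟩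
  · exact ((((hsq a).smul contDiff_const).add ((hsq b).smul contDiff_const)).add
      (contDiff_id.smul contDiff_const)).contDiffAt
  · refine complexVec_ext ?_ ?_ <;> simp
  · intro t
    have h1 : ∀ (c : ℝ) (v w : EuclideanSpace ℝ ι), inner ℝ v w = 0 →
        ‖√(1 + c ^ 2 * t ^ 2) • v + t • w‖ ^ 2 = (1 + c ^ 2 * t ^ 2) * ‖v‖ ^ 2 + t ^ 2 * ‖w‖ ^ 2 := by
      intro c v w hvw
      rw [norm_add_sq_real, real_inner_smul_left, real_inner_smul_right, hvw, norm_smul, norm_smul,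
        mul_pow, mul_pow, Real.norm_eq_abs, Real.norm_eq_abs, sq_abs, sq_abs,
        Real.sq_sqrt (by positivity)]
      ring
    simp only [cliffordCone, Set.mem_ofPred_eq, map_add, map_smul, reVec_complexVec,
      imVec_complexVec, smul_zero, add_zero, zero_add]
    rw [← sq_eq_sq₀ (norm_nonneg _) (norm_nonneg _), h1 _ _ _ hx', h1 _ _ _ hy', ← hxy, ha, hb]
    field_simp
    ring
  · have h := (((hsd a).smul_const (complexVec x 0)).add
      ((hsd b).smul_const (complexVec 0 y))).add
      ((hasDerivAt_id (0 : ℝ)).smul_const (complexVec x' y'))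
    exact h.congr_deriv (by simp)

/-- A vector normal to the cone `|x| = |y|` at a nonzero point `Q` vanishes if it is fixed by
some `conjSwap A` that fixes `Q`. -/
theorem eq_zero_of_normal_of_conjSwap {Q v : EuclideanSpace ℂ ι} (hQ : Q ∈ cliffordCone ι)
    (hQ0 : Q ≠ 0) {A : EuclideanSpace ℝ ι →ₗᵢ[ℝ] EuclideanSpace ℝ ι} (hA : conjSwap A Q = Q)
    (hv : conjSwap A v = v)
    (hnormal : ∀ (q : ℝ → EuclideanSpace ℂ ι) (q' : EuclideanSpace ℂ ι), ContDiffAt ℝ ∞ q 0 →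
      q 0 = Q → (∀ t, q t ∈ cliffordCone ι) → HasDerivAt q q' 0 → inner ℝ q' v = 0) :
    v = 0 := by
  have hQn : ‖reVec Q‖ = ‖imVec Q‖ := hQ
  have hx : reVec Q ≠ 0 := by
    intro h
    have h' : imVec Q = 0 := by rwa [h, norm_zero, eq_comm, norm_eq_zero] at hQn
    exact hQ0 (complexVec_ext (by simp [h]) (by simp [h']))
  set x := reVec Q with hxdef
  set y := imVec Q with hydef
  have hxn : ‖x‖ ^ 2 ≠ 0 := pow_ne_zero _ (norm_ne_zero_iff.2 hx)
  have hyn : ‖y‖ ^ 2 ≠ 0 := by rwa [← hQn]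
  have hQxy : complexVec x y = Q := complexVec_reVec_imVec Q
  have hAy : A y = x := by
    have := congrArg reVec hA
    simpa [conjSwap] using this
  have hAv : A (imVec v) = reVec v := by
    have := congrArg reVec hv
    simpa [conjSwap] using this
  set a := inner ℝ x (reVec v) / ‖x‖ ^ 2 with ha
  set b := inner ℝ y (imVec v) / ‖y‖ ^ 2 with hb
  have hxo : inner ℝ x (reVec v - a • x) = 0 := by
    rw [inner_sub_right, real_inner_smul_right, real_inner_self_eq_norm_sq, ha, div_mul_cancel₀ _ hxn, sub_self]
  have hyo : inner ℝ y (imVec v - b • y) = 0 := by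
    rw [inner_sub_right, real_inner_smul_right, real_inner_self_eq_norm_sq, hb, div_mul_cancel₀ _ hyn, sub_self]
  -- Testing v against the components of its own parts orthogonal to x and y gives a sum of two
  -- squares equal to zero; thus v = a x + i b y.
  obtain ⟨q, hq1, hq2, hq3, hq4⟩ := exists_curve_cliffordCone hx hQn hxo hyo
  have h1 := hnormal q _ hq1 (hq2.trans hQxy) hq3 hq4
  rw [real_inner_eq_reVec_imVec, reVec_complexVec, imVec_complexVec] at h1
  have h2 : inner ℝ (reVec v - a • x) (reVec v) = ‖reVec v - a • x‖ ^ 2 := by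
    rw [← real_inner_self_eq_norm_sq, inner_sub_right (reVec v - a • x), real_inner_smul_right,
      real_inner_comm, real_inner_comm x, hxo]; ring
  have h3 : inner ℝ (imVec v - b • y) (imVec v) = ‖imVec v - b • y‖ ^ 2 := by
    rw [← real_inner_self_eq_norm_sq, inner_sub_right (imVec v - b • y), real_inner_smul_right,
      real_inner_comm, real_inner_comm y, hyo]; ring
  rw [h2, h3] at h1
  have h4 : reVec v = a • x := by
    have : ‖reVec v - a • x‖ ^ 2 = 0 :=
      ((add_eq_zero_iff_of_nonneg (sq_nonneg _) (sq_nonneg _)).1 h1).1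
    rwa [sq_eq_zero_iff, norm_eq_zero, sub_eq_zero] at this
  have h5 : imVec v = b • y := by
    have : ‖imVec v - b • y‖ ^ 2 = 0 :=
      ((add_eq_zero_iff_of_nonneg (sq_nonneg _) (sq_nonneg _)).1 h1).2
    rwa [sq_eq_zero_iff, norm_eq_zero, sub_eq_zero] at this
  -- The radial direction gives a + b = 0, while invariance under the swap gives a = b.
  have h6 : inner ℝ Q v = 0 := by
    refine hnormal (fun t => (1 + t) • Q) Q (by fun_prop) (by simp)
      (fun t => smul_mem_cliffordCone _ hQ) ?_
    simpa using ((hasDerivAt_id (0 : ℝ)).const_add 1).smul_const Q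
  rw [real_inner_eq_reVec_imVec, h4, h5, real_inner_smul_right, real_inner_smul_right,
    real_inner_self_eq_norm_sq, real_inner_self_eq_norm_sq, ← hxdef, ← hydef, ← hQn] at h6
  have hab : a + b = 0 := by
    have : (a + b) * ‖x‖ ^ 2 = 0 := by linarith
    exact (mul_eq_zero.1 this).resolve_right hxn
  rw [h4, h5, map_smul, hAy] at hAv
  have hba : b = a := smul_left_injective ℝ hx hAv
  have ha0 : a = 0 := by linarith
  have hb0 : b = 0 := by linarith
  exact complexVec_ext (by rw [h4, ha0]; simp) (by rw [h5, hb0]; simp)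

/-- A linear isometry exchanging the real and imaginary parts of a vector of the cone. -/
theorem exists_conjSwap_eq_self {Q : EuclideanSpace ℂ ι} (hQ : Q ∈ cliffordCone ι) :
    ∃ A : EuclideanSpace ℝ ι →ₗᵢ[ℝ] EuclideanSpace ℝ ι, conjSwap A Q = Q := by
  have h1 : ‖reVec Q‖ = ‖imVec Q‖ := hQ
  -- Vectors of equal norm are exchanged by the reflection that negates their difference; if they
  -- coincide, it is the identity.
  set R := (Submodule.span ℝ {reVec Q - imVec Q})ᗮ.reflection
  have h2 : R (reVec Q) = imVec Q := Submodule.reflection_sub h1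
  have h3 : R (imVec Q) = reVec Q := by
    rw [← h2]; exact Submodule.reflection_reflection _ _
  refine ⟨R.toLinearIsometry, ?_⟩
  refine complexVec_ext ?_ ?_
  · rw [conjSwap, reVec_complexVec]; exact h3
  · rw [conjSwap, imVec_complexVec]; exact h2

end ConeTangent

/-! ### Vanishing of the mean curvature -/

section HelicoidMinimal

variable {L N : ℕ} {lam lam₀ : ℝ}

theorem meanCurvatureVector_generalizedHelicoid {d : ℕ} {U : Set (EuclideanSpace ℝ (Fin d))}
    {f : EuclideanSpace ℝ (Fin d) → HelicoidSpace L N} {u : EuclideanSpace ℝ (Fin d)}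
    (hf : IsLocalParam d (generalizedHelicoid lam lam₀ L N) U f) (hu : u ∈ U) :
    meanCurvatureVector f u = 0 := by
  obtain ⟨V, -, hfV⟩ := hf.image
  obtain ⟨Θ, r, Q, hQ, hp⟩ := mem_generalizedHelicoid_iff.1 (hfV.subset ⟨u, hu, rfl⟩).1
  by_cases hr : r = 0
  · refine meanCurvatureVector_eq_zero_of_axis hf hu (Θ := Θ) ?_
    rw [hp, hr, helicoidPoint, helicoidPoint, raysVec_zero, raysVec_zero]
  by_cases hQ0 : Q = 0
  · refine meanCurvatureVector_eq_zero_of_axis hf hu (Θ := Θ) ?_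
    rw [hp, hQ0, helicoidPoint, helicoidPoint, raysVec_zero, map_zero]
  obtain ⟨A, hA⟩ := exists_conjSwap_eq_self hQ
  have h1 := screwFlip_meanCurvatureVector hf hu hp A hA
  have h2 := snd_eq_zero_of_screwFlip h1
  have h3 : rayReflection (Fin (N + 1)) r (meanCurvatureVector f u).fst =
      (meanCurvatureVector f u).fst :=
    congrArg (fun q : HelicoidSpace L N => q.fst) (rayFlip_meanCurvatureVector hf hu hr hp)
  obtain ⟨v', hv'⟩ := exists_raysVec_of_rayReflection_eq h3
  -- Undoing the rotation puts v in the same frame as Q, where the flip acts as the plain swap.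
  set v := (phase (lam * Θ))⁻¹ • v' with hv
  have hm : (meanCurvatureVector f u).fst = phase (lam * Θ) • raysVec r v := by
    rw [hv', ← map_smul, hv, smul_inv_smul₀ (phase_ne_zero _)]
  have hswap : conjSwap A v = v := by
    have h4 : blockConjSwap (phase (lam * (2 * Θ))) (norm_phase _) A
        (meanCurvatureVector f u).fst = (meanCurvatureVector f u).fst :=
      congrArg (fun q : HelicoidSpace L N => q.fst) h1
    rw [hm, ← map_smul, blockConjSwap_raysVec, conjSwap_smul, conj_phase, map_smul, map_smul,
      smul_smul, ← phase_add] at h4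
    have h5 : lam * (2 * Θ) + -(lam * Θ) = lam * Θ := by ring
    rw [h5] at h4
    exact raysVec_injective hr (smul_right_injective _ (phase_ne_zero _) h4)
  have hv0 : v = 0 := eq_zero_of_normal_of_conjSwap hQ hQ0 hA hswap
    fun q q' hq hq0 hqK hq' => inner_helicoid_velocity hf hu hr hp hm hq hq0 hqK hq'
  have h6 : (meanCurvatureVector f u).fst = 0 := by rw [hm, hv0, map_zero, smul_zero]
  exact WithLp.ofLp_injective 2 (Prod.ext h6 h2)

end HelicoidMinimal

/-! ### Charts with smooth left inverses -/

section SmoothChart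

/-- Near `p`, the set `S` is parametrized by an open subset of a `d`-dimensional space
through a smooth map with a smooth left inverse. -/
def HasSmoothChart {E : Type*} [NormedAddCommGroup E] [NormedSpace ℝ E] (d : ℕ) (S : Set E)
    (p : E) : Prop :=
  ∃ (M : Type) (_ : NormedAddCommGroup M) (_ : NormedSpace ℝ M) (_ : FiniteDimensional ℝ M)
    (U : Set M) (V : Set E) (f : M → E) (g : E → M), Module.finrank ℝ M = d ∧ IsOpen U ∧ IsOpen V ∧
    ContDiffOn ℝ ∞ f U ∧ ContDiffOn ℝ ∞ g V ∧ (∀ u ∈ U, g (f u) = u) ∧ f '' U = S ∩ V ∧ p ∈ S ∩ V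

/-- A smooth left inverse yields injectivity of the derivative by the chain rule and the embedding
property by continuity. -/
theorem HasSmoothChart.mem_regularPart {E : Type*} [NormedAddCommGroup E] [InnerProductSpace ℝ E]
    {d : ℕ} {S : Set E} {p : E} (h : HasSmoothChart d S p) : p ∈ regularPart d S := by
  obtain ⟨M, _, _, _, U, V, f, g, hd, hU, hV, hf, hg, hgf, hfU, hp⟩ := h
  set e : EuclideanSpace ℝ (Fin d) ≃L[ℝ] M :=
    ContinuousLinearEquiv.ofFinrankEq (by rw [hd, finrank_euclideanSpace_fin]) with he
  have hfV : ∀ u ∈ U, f u ∈ V := fun u hu => (hfU.subset ⟨u, hu, rfl⟩).2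
  have hsm : ContDiffOn ℝ ∞ (f ∘ e) (e ⁻¹' U) :=
    hf.comp e.contDiff.contDiffOn (Set.mapsTo_preimage _ _)
  have hoU : IsOpen (e ⁻¹' U) := hU.preimage e.continuous
  have himg : (f ∘ e) '' (e ⁻¹' U) = f '' U := by
    rw [Set.image_comp, Set.image_preimage_eq _ e.surjective]
  refine ⟨e ⁻¹' U, f ∘ e, ⟨hoU, hsm, ?_, ?_, V, hV, himg.trans hfU⟩, by rwa [himg, hfU]⟩
  · intro u hu
    have h1 : DifferentiableAt ℝ (f ∘ e) u :=
      (hsm.contDiffAt (hoU.mem_nhds hu)).differentiableAt (by simp)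
    have h2 : DifferentiableAt ℝ g ((f ∘ e) u) :=
      (hg.contDiffAt (hV.mem_nhds (hfV _ hu))).differentiableAt (by simp)
    have h3 := h2.hasFDerivAt.comp u h1.hasFDerivAt
    have h4 : HasFDerivAt (g ∘ (f ∘ e)) (e : EuclideanSpace ℝ (Fin d) →L[ℝ] M) u := by
      refine e.hasFDerivAt.congr_of_eventuallyEq ?_
      filter_upwards [hoU.mem_nhds hu] with z hz
      exact hgf _ hz
    have h5 := h3.unique h4
    have h6 : Function.Injective ((fderiv ℝ g ((f ∘ e) u)) ∘ (fderiv ℝ (f ∘ e) u)) := by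
      rw [← ContinuousLinearMap.coe_comp, h5]
      exact e.injective
    exact h6.of_comp
  · set f₁ : (e ⁻¹' U : Set _) → V := fun z => ⟨f (e z), hfV _ z.2⟩ with hf₁
    have hc1 : Continuous f₁ := (hsm.continuousOn.domRestrict).subtype_mk _
    have hc2 : Continuous (V.domRestrict g) := hg.continuousOn.domRestrict
    have h1 : Topology.IsEmbedding f₁ := by
      refine Topology.IsEmbedding.of_comp hc1 hc2 ?_
      have : V.domRestrict g ∘ f₁ = e ∘ Subtype.val := by
        ext z; exact hgf _ z.2
      rw [this]
      exact e.toHomeomorph.isEmbedding.comp Topology.IsEmbedding.subtypeVal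
    exact Topology.IsEmbedding.subtypeVal.comp h1

theorem ContDiffOn.raysVec {ι κ M : Type*} [Fintype ι] [Fintype κ] [NormedAddCommGroup M]
    [NormedSpace ℝ M] {s : Set M} {r : M → EuclideanSpace ℝ ι} {q : M → EuclideanSpace ℂ κ}
    (hr : ContDiffOn ℝ ∞ r s) (hq : ContDiffOn ℝ ∞ q s) :
    ContDiffOn ℝ ∞ (fun x => raysVec (r x) (q x)) s := by
  refine contDiffOn_piLp' 2 fun sk => ?_
  have h1 : ContDiffOn ℝ ∞ (fun x => (r x) sk.1) s := (contDiffOn_piLp 2).1 hr sk.1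
  have h2 : ContDiffOn ℝ ∞ (fun x => (q x) sk.2) s := (contDiffOn_piLp 2).1 hq sk.2
  exact (Complex.ofRealCLM.contDiff.comp_contDiffOn h1).mul h2

/-! ### Charts of the Clifford cone and of rays over a cone -/

section Rays

variable {ι κ : Type}

section

variable [Fintype ι]

/-- The contraction of `ℝ^ι ⊗ ℂ^κ` with `r / ‖r‖²`. -/
noncomputable def rayContraction (r : EuclideanSpace ℝ ι) :
    EuclideanSpace ℂ (ι × κ) →ₗ[ℝ] EuclideanSpace ℂ κ where
  toFun Z := WithLp.toLp 2 fun k => ∑ s, ((r s / ‖r‖ ^ 2 : ℝ) : ℂ) * Z (s, k)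
  map_add' _ _ := by ext; simp [mul_add, Finset.sum_add_distrib]
  map_smul' _ _ := by ext; simp [Finset.mul_sum, mul_left_comm]

theorem rayContraction_raysVec (r r' : EuclideanSpace ℝ ι) (Q : EuclideanSpace ℂ κ) :
    rayContraction r (raysVec r' Q) = (inner ℝ r r' / ‖r‖ ^ 2) • Q := by
  ext k
  change ∑ s, ((r s / ‖r‖ ^ 2 : ℝ) : ℂ) * ((r' s : ℂ) * Q k) = _
  simp only [PiLp.smul_apply, Complex.real_smul, PiLp.inner_apply, Finset.sum_div,
    Complex.ofReal_sum, Finset.sum_mul]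
  refine Finset.sum_congr rfl fun s _ => ?_
  simp; ring

end

variable [Fintype κ]

/-- The ray coefficients of `Z` with respect to the direction `Q`. -/
noncomputable def rayCoeff (Q : EuclideanSpace ℂ κ) (Z : EuclideanSpace ℂ (ι × κ)) :
    EuclideanSpace ℝ ι :=
  WithLp.toLp 2 fun s => inner ℝ Q (WithLp.toLp 2 fun k => Z (s, k)) / ‖Q‖ ^ 2

theorem rayCoeff_raysVec {Q : EuclideanSpace ℂ κ} (hQ : Q ≠ 0) (r : EuclideanSpace ℝ ι) :
    rayCoeff Q (raysVec r Q) = r := by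
  have hn : ‖Q‖ ^ 2 ≠ 0 := pow_ne_zero _ (norm_ne_zero_iff.2 hQ)
  ext s
  have h1 : (WithLp.toLp 2 fun k => raysVec r Q (s, k) : EuclideanSpace ℂ κ) = r s • Q := by
    ext k; simp
  change inner ℝ Q (WithLp.toLp 2 fun k => raysVec r Q (s, k)) / ‖Q‖ ^ 2 = r s
  rw [h1, real_inner_smul_right, real_inner_self_eq_norm_sq, mul_div_assoc, div_self hn, mul_one]

variable [Fintype ι]

/-- The rays over a cone are smooth wherever the cone is. -/
theorem HasSmoothChart.rays {m k : ℕ} (hm : Fintype.card ι = m + 1)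
    {K : Set (EuclideanSpace ℂ κ)} (hK : ∀ (a : ℝ), ∀ Q ∈ K, a • Q ∈ K)
    {Q₀ : EuclideanSpace ℂ κ} (h : HasSmoothChart k K Q₀) (hQ₀ : Q₀ ≠ 0)
    {r₀ : EuclideanSpace ℝ ι} (hr₀ : r₀ ≠ 0) :
    HasSmoothChart (m + k) {Z | ∃ r : EuclideanSpace ℝ ι, ∃ Q ∈ K, Z = raysVec r Q}
      (raysVec r₀ Q₀) := by
  obtain ⟨M, _, _, _, U, V, f, g, hd, hU, hV, hf, hg, hgf, hfU, hp⟩ := h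
  have hr2 : ‖r₀‖ ^ 2 ≠ 0 := pow_ne_zero _ (norm_ne_zero_iff.2 hr₀)
  -- The ambiguity r ⊗ Q = c⁻¹r ⊗ cQ is removed by requiring r ∈ r₀ + W. This costs one dimension,
  -- and contraction with r₀/‖r₀‖² then recovers Q.
  set W := (Submodule.span ℝ {r₀})ᗮ with hW
  have : Fact (Module.finrank ℝ (EuclideanSpace ℝ ι) = m + 1) := ⟨by
    rw [finrank_euclideanSpace, hm]⟩
  have hWd : Module.finrank ℝ W = m := Submodule.finrank_orthogonal_span_singleton hr₀
  set C : EuclideanSpace ℂ (ι × κ) →L[ℝ] EuclideanSpace ℂ κ :=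
    LinearMap.toContinuousLinearMap (rayContraction r₀) with hC
  have hCr : ∀ r Q, C (raysVec r Q) = (inner ℝ r₀ r / ‖r₀‖ ^ 2) • Q := rayContraction_raysVec r₀
  have hCa : ∀ (a : W) Q, C (raysVec (r₀ + (a : EuclideanSpace ℝ ι)) Q) = Q := by
    intro a Q
    have : inner ℝ r₀ (a : EuclideanSpace ℝ ι) = 0 := Submodule.mem_orthogonal_singleton_iff_inner_right.1 a.2
    rw [hCr, inner_add_right, this, add_zero, real_inner_self_eq_norm_sq, div_self hr2, one_smul]
  refine ⟨W × M, inferInstance, inferInstance, inferInstance,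
    -- Zero is excluded because `rayCoeff` divides by ‖Q‖².
    Set.univ ×ˢ (U ∩ f ⁻¹' {0}ᶜ), C ⁻¹' (V ∩ {0}ᶜ),
    fun z => raysVec (r₀ + (z.1 : EuclideanSpace ℝ ι)) (f z.2),
    fun Z => (W.orthogonalProjectionOnto (rayCoeff (C Z) Z), g (C Z)), ?_, ?_, ?_, ?_, ?_, ?_, ?_, ?_⟩
  · rw [Module.finrank_prod, hWd, hd]
  · exact isOpen_univ.prod (hf.continuousOn.isOpen_inter_preimage hU isOpen_compl_singleton)
  · exact (hV.inter isOpen_compl_singleton).preimage C.continuous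
  · refine ContDiffOn.raysVec ?_ ?_
    · exact (contDiff_const.add (W.subtypeL.contDiff.comp contDiff_fst)).contDiffOn
    · exact hf.comp contDiff_snd.contDiffOn fun z hz => hz.2.1
  · refine ContDiffOn.prodMk ?_ ?_
    · refine (ContinuousLinearMap.contDiff _).comp_contDiffOn (contDiffOn_piLp' 2 fun s => ?_)
      refine ContDiffOn.div ?_ ?_ ?_
      · refine (C.contDiff.inner ℝ ?_).contDiffOn
        exact contDiff_piLp' 2 fun k => contDiff_piLp_apply 2
      · exact (C.contDiff.norm_sq ℝ).contDiffOn
      · intro Z hZ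
        exact pow_ne_zero _ (norm_ne_zero_iff.2 hZ.2)
    · exact hg.comp C.contDiff.contDiffOn fun Z hZ => hZ.1
  · rintro ⟨a, u⟩ ⟨-, hu, hu0⟩
    simp only [hCa]
    rw [rayCoeff_raysVec hu0, hgf u hu, map_add]
    simp [hW]
  · ext Z
    constructor
    · rintro ⟨⟨a, u⟩, ⟨-, hu, hu0⟩, rfl⟩
      have h1 := hfU.subset ⟨u, hu, rfl⟩
      refine ⟨⟨_, _, h1.1, rfl⟩, ?_⟩
      rw [Set.mem_preimage, hCa]
      exact ⟨h1.2, hu0⟩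
    · rintro ⟨⟨r, Q, hQ, rfl⟩, hZ⟩
      rw [Set.mem_preimage, hCr] at hZ
      set c := inner ℝ r₀ r / ‖r₀‖ ^ 2 with hc
      have hc0 : c ≠ 0 := by
        intro h0
        exact hZ.2 (by rw [h0]; simp)
      obtain ⟨u, hu, hfu⟩ := hfU.superset ⟨hK c Q hQ, hZ.1⟩
      have ha : c⁻¹ • r - r₀ ∈ W := by
        rw [hW, Submodule.mem_orthogonal_singleton_iff_inner_right, inner_sub_right, real_inner_smul_right,
          real_inner_self_eq_norm_sq]
        have : inner ℝ r₀ r = c * ‖r₀‖ ^ 2 := by rw [hc]; field_simp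
        rw [this]; field_simp; ring
      refine ⟨⟨⟨_, ha⟩, u⟩, ⟨trivial, hu, ?_⟩, ?_⟩
      · rw [Set.mem_preimage, hfu]; exact hZ.2
      · simp only [hfu]
        rw [add_sub_cancel, raysVec_smul, raysVec_smul_right, inv_smul_smul₀ hc0]
  · refine ⟨⟨r₀, Q₀, hp.1, rfl⟩, ?_⟩
    rw [Set.mem_preimage, hCr, real_inner_self_eq_norm_sq, div_self hr2, one_smul]
    exact ⟨hp.2, hQ₀⟩

theorem contDiff_reVec : ContDiff ℝ ∞ (reVec : EuclideanSpace ℂ κ → EuclideanSpace ℝ κ) :=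
  contDiff_piLp' 2 fun k => Complex.reCLM.contDiff.comp (contDiff_piLp_apply 2 (i := k))

theorem contDiff_imVec : ContDiff ℝ ∞ (imVec : EuclideanSpace ℂ κ → EuclideanSpace ℝ κ) :=
  contDiff_piLp' 2 fun k => Complex.imCLM.contDiff.comp (contDiff_piLp_apply 2 (i := k))

theorem ContDiffOn.complexVec {M : Type*} [NormedAddCommGroup M]
    [NormedSpace ℝ M] {s : Set M} {x y : M → EuclideanSpace ℝ κ}
    (hx : ContDiffOn ℝ ∞ x s) (hy : ContDiffOn ℝ ∞ y s) :
    ContDiffOn ℝ ∞ (fun z => complexVec (x z) (y z)) s := by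
  refine contDiffOn_piLp' 2 fun k => ?_
  have h1 : ContDiffOn ℝ ∞ (fun z => (x z) k) s := (contDiffOn_piLp 2).1 hx k
  have h2 : ContDiffOn ℝ ∞ (fun z => (y z) k) s := (contDiffOn_piLp 2).1 hy k
  exact (Complex.ofRealCLM.contDiff.comp_contDiffOn h1).add
    (contDiffOn_const.mul (Complex.ofRealCLM.contDiff.comp_contDiffOn h2))

theorem hasSmoothChart_univ (Q : EuclideanSpace ℂ κ) :
    HasSmoothChart (2 * Fintype.card κ) Set.univ Q := by
  refine ⟨EuclideanSpace ℝ κ × EuclideanSpace ℝ κ, inferInstance, inferInstance, inferInstance,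
    Set.univ, Set.univ, fun z => complexVec z.1 z.2, fun Q => (reVec Q, imVec Q), ?_, isOpen_univ,
    isOpen_univ, ?_, ?_, ?_, ?_, by simp⟩
  · rw [Module.finrank_prod, finrank_euclideanSpace, two_mul]
  · exact ContDiffOn.complexVec contDiff_fst.contDiffOn contDiff_snd.contDiffOn
  · exact (contDiff_reVec.prodMk contDiff_imVec).contDiffOn
  · simp
  · ext Q
    simp only [Set.image_univ, Set.mem_range, Set.inter_self, Set.mem_univ, iff_true]
    exact ⟨(reVec Q, imVec Q), complexVec_reVec_imVec Q⟩

theorem reVec_ne_zero_of_mem_cliffordCone {Q : EuclideanSpace ℂ κ} (hQ : Q ∈ cliffordCone κ)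
    (hQ0 : Q ≠ 0) : reVec Q ≠ 0 := by
  have hQn : ‖reVec Q‖ = ‖imVec Q‖ := hQ
  intro h
  have h' : imVec Q = 0 := by rwa [h, norm_zero, eq_comm, norm_eq_zero] at hQn
  exact hQ0 (complexVec_ext (by simp [h]) (by simp [h']))

/-- The part x ≠ 0 is free and fixes the length of y. The direction of y, near that of y₀, is
charted by central projection to the affine hyperplane y₀ + W, giving (n + 1) + n parameters. -/
theorem hasSmoothChart_cliffordCone {n : ℕ} (hn : Fintype.card κ = n + 1)
    {Q₀ : EuclideanSpace ℂ κ} (hQ₀ : Q₀ ∈ cliffordCone κ) (h0 : Q₀ ≠ 0) :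
    HasSmoothChart (2 * n + 1) (cliffordCone κ) Q₀ := by
  have hx0 := reVec_ne_zero_of_mem_cliffordCone hQ₀ h0
  set y₀ := imVec Q₀ with hy₀
  have hy0 : y₀ ≠ 0 := by
    rw [← norm_ne_zero_iff, hy₀, ← show ‖reVec Q₀‖ = ‖imVec Q₀‖ from hQ₀]
    exact norm_ne_zero_iff.2 hx0
  have hy2 : ‖y₀‖ ^ 2 ≠ 0 := pow_ne_zero _ (norm_ne_zero_iff.2 hy0)
  have hy2p : 0 < ‖y₀‖ ^ 2 := lt_of_le_of_ne (sq_nonneg _) hy2.symm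
  set W := (Submodule.span ℝ {y₀})ᗮ with hW
  have : Fact (Module.finrank ℝ (EuclideanSpace ℝ κ) = n + 1) := ⟨by
    rw [finrank_euclideanSpace, hn]⟩
  have hWd : Module.finrank ℝ W = n := Submodule.finrank_orthogonal_span_singleton hy0
  have hin : ∀ w : W, inner ℝ y₀ (y₀ + (w : EuclideanSpace ℝ κ)) = ‖y₀‖ ^ 2 := by
    intro w
    have : inner ℝ y₀ (w : EuclideanSpace ℝ κ) = 0 := Submodule.mem_orthogonal_singleton_iff_inner_right.1 w.2
    rw [inner_add_right, this, add_zero, real_inner_self_eq_norm_sq]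
  have hne : ∀ w : W, y₀ + (w : EuclideanSpace ℝ κ) ≠ 0 := by
    intro w h
    have := hin w
    rw [h, inner_zero_right] at this
    exact hy2 this.symm
  refine ⟨EuclideanSpace ℝ κ × W, inferInstance, inferInstance, inferInstance,
    {z | z.1 ≠ 0}, {Q | reVec Q ≠ 0 ∧ 0 < inner ℝ y₀ (imVec Q)},
    fun z => complexVec z.1 ((‖z.1‖ / ‖y₀ + (z.2 : EuclideanSpace ℝ κ)‖) •
      (y₀ + (z.2 : EuclideanSpace ℝ κ))),
    fun Q => (reVec Q, W.orthogonalProjectionOnto ((‖y₀‖ ^ 2 / inner ℝ y₀ (imVec Q)) • imVec Q)),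
    ?_, ?_, ?_, ?_, ?_, ?_, ?_, ?_⟩
  · rw [Module.finrank_prod, hWd, finrank_euclideanSpace, hn]; ring
  · exact isOpen_ne_fun continuous_fst continuous_const
  · exact IsOpen.and (isOpen_ne_fun contDiff_reVec.continuous continuous_const)
      (isOpen_lt continuous_const (continuous_const.inner contDiff_imVec.continuous))
  · have h1 : ContDiff ℝ ∞ fun z : EuclideanSpace ℝ κ × W => y₀ + (z.2 : EuclideanSpace ℝ κ) :=
      contDiff_const.add (W.subtypeL.contDiff.comp contDiff_snd)
    refine ContDiffOn.complexVec contDiff_fst.contDiffOn (ContDiffOn.smul (ContDiffOn.div ?_ ?_ ?_)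
      h1.contDiffOn)
    · exact contDiff_fst.contDiffOn.norm ℝ fun z hz => hz
    · exact h1.contDiffOn.norm ℝ fun z _ => hne z.2
    · exact fun z _ => norm_ne_zero_iff.2 (hne z.2)
  · refine contDiff_reVec.contDiffOn.prodMk ((ContinuousLinearMap.contDiff _).comp_contDiffOn
      (ContDiffOn.smul (ContDiffOn.div contDiffOn_const ?_ ?_) contDiff_imVec.contDiffOn))
    · exact (contDiff_const.inner ℝ contDiff_imVec).contDiffOn
    · exact fun Q hQ => hQ.2.ne'
  · rintro ⟨x, w⟩ hx
    have hxn : ‖x‖ ≠ 0 := norm_ne_zero_iff.2 hx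
    have hwn : ‖y₀ + (w : EuclideanSpace ℝ κ)‖ ≠ 0 := norm_ne_zero_iff.2 (hne w)
    simp only [reVec_complexVec, imVec_complexVec]
    rw [real_inner_smul_right, hin, smul_smul]
    have : ‖y₀‖ ^ 2 / (‖x‖ / ‖y₀ + (w : EuclideanSpace ℝ κ)‖ * ‖y₀‖ ^ 2) *
        (‖x‖ / ‖y₀ + (w : EuclideanSpace ℝ κ)‖) = 1 := by
      field_simp
    rw [this, one_smul, map_add]
    simp [hW]
  · ext Q
    constructor
    · rintro ⟨⟨x, w⟩, hx, rfl⟩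
      have hxn : 0 < ‖x‖ := norm_pos_iff.2 hx
      have hwn : 0 < ‖y₀ + (w : EuclideanSpace ℝ κ)‖ := norm_pos_iff.2 (hne w)
      refine ⟨?_, ?_, ?_⟩
      · change ‖reVec (complexVec _ _)‖ = ‖imVec (complexVec _ _)‖
        rw [reVec_complexVec, imVec_complexVec, norm_smul, norm_div, norm_norm, norm_norm]
        field_simp
      · simpa using hx
      · rw [imVec_complexVec, real_inner_smul_right, hin]
        positivity
    · rintro ⟨hQ, hQ1, hQ2⟩
      have hQn : ‖reVec Q‖ = ‖imVec Q‖ := hQ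
      set c := ‖y₀‖ ^ 2 / inner ℝ y₀ (imVec Q) with hc
      have hc0 : 0 < c := div_pos hy2p hQ2
      have hw : c • imVec Q - y₀ ∈ W := by
        rw [hW, Submodule.mem_orthogonal_singleton_iff_inner_right, inner_sub_right, real_inner_smul_right,
          real_inner_self_eq_norm_sq, hc, div_mul_cancel₀ _ hQ2.ne', sub_self]
      refine ⟨⟨reVec Q, ⟨_, hw⟩⟩, hQ1, ?_⟩
      refine complexVec_ext (by rw [reVec_complexVec]) ?_
      have h1 : ‖imVec Q‖ ≠ 0 := by rw [← hQn]; exact norm_ne_zero_iff.2 hQ1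
      rw [imVec_complexVec, add_sub_cancel, norm_smul, smul_smul, hQn, Real.norm_of_nonneg hc0.le]
      have : ‖imVec Q‖ / (c * ‖imVec Q‖) * c = 1 := by field_simp
      rw [this, one_smul]
  · refine ⟨hQ₀, hx0, ?_⟩
    rw [← hy₀, real_inner_self_eq_norm_sq]; exact hy2p

end Rays

end SmoothChart

/-! ### Regular part, density and screw invariance of the helicoid -/

section HelicoidRegular

variable {L N : ℕ}

theorem contDiff_phase : ContDiff ℝ ∞ phase := by
  unfold phase
  exact (contDiff_const.mul Complex.ofRealCLM.contDiff).cexp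

theorem contDiff_helicoid_fst :
    ContDiff ℝ ∞ (fun p : HelicoidSpace L N => p.fst) :=
  contDiff_fst.comp (WithLp.contDiff_ofLp)

theorem contDiff_helicoid_snd :
    ContDiff ℝ ∞ (fun p : HelicoidSpace L N => p.snd) :=
  contDiff_snd.comp (WithLp.contDiff_ofLp)

theorem ContDiffOn.phase_smul {M ι : Type*} [Fintype ι] [NormedAddCommGroup M] [NormedSpace ℝ M]
    {s : Set M} {α : M → ℝ} {Z : M → EuclideanSpace ℂ ι} (hα : ContDiffOn ℝ ∞ α s)
    (hZ : ContDiffOn ℝ ∞ Z s) : ContDiffOn ℝ ∞ (fun x => phase (α x) • Z x) s := by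
  refine contDiffOn_piLp' 2 fun k => ?_
  have h2 : ContDiffOn ℝ ∞ (fun x => (Z x) k) s := (contDiffOn_piLp 2).1 hZ k
  exact (contDiff_phase.comp_contDiffOn hα).mul h2

theorem HasSmoothChart.level_zero {k : ℕ} {S : Set (EuclideanSpace ℂ (Fin L × Fin (N + 1)))}
    {Z₀ : EuclideanSpace ℂ (Fin L × Fin (N + 1))} (h : HasSmoothChart k S Z₀) :
    HasSmoothChart k {p : HelicoidSpace L N | ∃ Z ∈ S, p = WithLp.toLp 2 (Z, 0)}
      (WithLp.toLp 2 (Z₀, 0)) := by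
  obtain ⟨M, _, _, _, U, V, f, g, hd, hU, hV, hf, hg, hgf, hfU, hp⟩ := h
  refine ⟨M, inferInstance, inferInstance, inferInstance, U,
    (fun p : HelicoidSpace L N => p.fst) ⁻¹' V, fun u => WithLp.toLp 2 (f u, 0),
    fun p => g p.fst, hd, hU, hV.preimage contDiff_helicoid_fst.continuous, ?_, ?_, hgf, ?_, ?_⟩
  · exact WithLp.contDiff_toLp.comp_contDiffOn (hf.prodMk contDiffOn_const)
  · exact hg.comp contDiff_helicoid_fst.contDiffOn fun p hp => hp
  · ext p
    constructor
    · rintro ⟨u, hu, rfl⟩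
      have h1 := hfU.subset ⟨u, hu, rfl⟩
      exact ⟨⟨_, h1.1, rfl⟩, h1.2⟩
    · rintro ⟨⟨Z, hZ, rfl⟩, hZV⟩
      obtain ⟨u, hu, rfl⟩ := hfU.superset ⟨hZ, hZV⟩
      exact ⟨u, hu, rfl⟩
  · exact ⟨⟨_, hp.1, rfl⟩, hp.2⟩

theorem HasSmoothChart.screw {lam lam₀ : ℝ} (h0 : lam₀ ≠ 0) {k : ℕ}
    {S : Set (EuclideanSpace ℂ (Fin L × Fin (N + 1)))}
    {Z₀ : EuclideanSpace ℂ (Fin L × Fin (N + 1))} (h : HasSmoothChart k S Z₀) (Θ₀ : ℝ) :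
    HasSmoothChart (k + 1) {p : HelicoidSpace L N | ∃ Θ : ℝ, ∃ Z ∈ S,
      p = WithLp.toLp 2 (phase (lam * Θ) • Z, lam₀ * Θ)}
      (WithLp.toLp 2 (phase (lam * Θ₀) • Z₀, lam₀ * Θ₀)) := by
  obtain ⟨M, _, _, _, U, V, f, g, hd, hU, hV, hf, hg, hgf, hfU, hp⟩ := h
  -- As λ₀ ≠ 0, the last coordinate determines Θ smoothly, so the rotation can be undone on the
  -- whole ambient space.
  set B : HelicoidSpace L N → EuclideanSpace ℂ (Fin L × Fin (N + 1)) :=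
    fun p => phase (-(lam * (p.snd / lam₀))) • p.fst with hB
  have hBc : ContDiff ℝ ∞ B := contDiffOn_univ.1 (ContDiffOn.phase_smul
    ((contDiff_const.mul (contDiff_helicoid_snd.div_const lam₀)).neg).contDiffOn
    contDiff_helicoid_fst.contDiffOn)
  have hB1 : ∀ (Θ : ℝ) Z, B (WithLp.toLp 2 (phase (lam * Θ) • Z, lam₀ * Θ)) = Z := by
    intro Θ Z
    change phase (-(lam * (lam₀ * Θ / lam₀))) • phase (lam * Θ) • Z = Z
    rw [mul_div_cancel_left₀ _ h0, smul_smul, ← phase_add, neg_add_cancel, phase_zero, one_smul]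
  refine ⟨ℝ × M, inferInstance, inferInstance, inferInstance, Set.univ ×ˢ U, B ⁻¹' V,
    fun z => WithLp.toLp 2 (phase (lam * z.1) • f z.2, lam₀ * z.1),
    fun p => (p.snd / lam₀, g (B p)), ?_, isOpen_univ.prod hU, hV.preimage hBc.continuous,
    ?_, ?_, ?_, ?_, ?_⟩
  · rw [Module.finrank_prod, hd, Module.finrank_self, add_comm]
  · refine WithLp.contDiff_toLp.comp_contDiffOn (ContDiffOn.prodMk (ContDiffOn.phase_smul
      (contDiff_const.mul contDiff_fst).contDiffOn ?_) (contDiff_const.mul contDiff_fst).contDiffOn)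
    exact hf.comp contDiff_snd.contDiffOn fun z hz => hz.2
  · exact (contDiff_helicoid_snd.div_const lam₀).contDiffOn.prodMk
      (hg.comp hBc.contDiffOn fun p hp => hp)
  · rintro ⟨Θ, u⟩ ⟨-, hu⟩
    simp only [hB1, hgf u hu]
    exact Prod.ext (mul_div_cancel_left₀ _ h0) rfl
  · ext p
    constructor
    · rintro ⟨⟨Θ, u⟩, ⟨-, hu⟩, rfl⟩
      have h1 := hfU.subset ⟨u, hu, rfl⟩
      refine ⟨⟨_, _, h1.1, rfl⟩, ?_⟩
      rw [Set.mem_preimage, hB1]; exact h1.2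
    · rintro ⟨⟨Θ, Z, hZ, rfl⟩, hZV⟩
      rw [Set.mem_preimage, hB1] at hZV
      obtain ⟨u, hu, rfl⟩ := hfU.superset ⟨hZ, hZV⟩
      exact ⟨(Θ, u), ⟨trivial, hu⟩, rfl⟩
  · refine ⟨⟨_, _, hp.1, rfl⟩, ?_⟩
    rw [Set.mem_preimage, hB1]; exact hp.2

/-- Every complex vector can be rotated into the cone `|x| = |y|`. -/
theorem exists_phase_smul_mem_cliffordCone {ι : Type*} [Fintype ι] (Q : EuclideanSpace ℂ ι) :
    ∃ α : ℝ, phase α • Q ∈ cliffordCone ι := by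
  set h : ℝ → ℝ := fun α => ‖reVec (phase α • Q)‖ - ‖imVec (phase α • Q)‖ with hh
  have hsm : Continuous fun α : ℝ => phase α • Q := contDiff_phase.continuous.smul continuous_const
  have hc : Continuous h :=
    ((LinearMap.toContinuousLinearMap reVec).continuous.comp hsm).norm.sub
      ((LinearMap.toContinuousLinearMap imVec).continuous.comp hsm).norm
  have hpi : phase (Real.pi / 2) = Complex.I := by
    rw [phase, mul_comm]; push_cast; exact Complex.exp_pi_div_two_mul_I
  -- Multiplication by i exchanges the two norms, so h changes sign on a quarter turn and the
  -- intermediate value theorem applies.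
  have h1 : h (Real.pi / 2) = -h 0 := by
    have e1 : reVec (Complex.I • Q) = -imVec Q := by ext; simp
    have e2 : imVec (Complex.I • Q) = reVec Q := by ext; simp
    simp only [hh, hpi, phase_zero, one_smul, e1, e2, norm_neg]
    ring
  obtain ⟨α, hα⟩ : ∃ α, h α = 0 := by
    rcases le_total (h 0) 0 with h2 | h2
    · exact mem_range_of_exists_le_of_exists_ge hc ⟨0, h2⟩ ⟨Real.pi / 2, by linarith⟩
    · exact mem_range_of_exists_le_of_exists_ge hc ⟨Real.pi / 2, by linarith⟩ ⟨0, h2⟩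
  exact ⟨α, sub_eq_zero.1 hα⟩

/-- The generalized helicoid is smooth away from the axis. -/
theorem helicoidPoint_mem_regularPart (hL : 1 ≤ L) (lam lam₀ Θ : ℝ)
    {r : EuclideanSpace ℝ (Fin L)} (hr : r ≠ 0) {Q : EuclideanSpace ℂ (Fin (N + 1))}
    (hQ : Q ∈ cliffordCone (Fin (N + 1))) (hQ0 : Q ≠ 0) :
    helicoidPoint lam lam₀ Θ r Q ∈
      regularPart (helicoidDim lam lam₀ L N) (generalizedHelicoid lam lam₀ L N) := by
  obtain ⟨m, rfl⟩ : ∃ m, L = m + 1 := ⟨L - 1, by omega⟩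
  have hcone := (hasSmoothChart_cliffordCone (Fintype.card_fin (N + 1)) hQ hQ0).rays
    (Fintype.card_fin (m + 1)) (fun a _ h => smul_mem_cliffordCone a h) hQ0 hr
  apply HasSmoothChart.mem_regularPart
  by_cases h0 : lam₀ = 0
  · subst h0
    by_cases h : lam = 0
    · subst h
      have h1 : generalizedHelicoid 0 0 (m + 1) N =
          {p | ∃ Z ∈ {Z | ∃ r : EuclideanSpace ℝ (Fin (m + 1)),
          ∃ Q ∈ cliffordCone (Fin (N + 1)), Z = raysVec r Q}, p = WithLp.toLp 2 (Z, 0)} := by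
        ext p
        rw [mem_generalizedHelicoid_iff]
        constructor
        · rintro ⟨Θ, r, Q, hQ, rfl⟩
          exact ⟨_, ⟨r, Q, hQ, rfl⟩, by simp [helicoidPoint, phase_zero]⟩
        · rintro ⟨_, ⟨r, Q, hQ, rfl⟩, rfl⟩
          exact ⟨0, r, Q, hQ, by simp [helicoidPoint, phase_zero]⟩
      have h2 : helicoidPoint 0 0 Θ r Q = WithLp.toLp 2 (raysVec r Q, 0) := by
        simp [helicoidPoint, phase_zero]
      have h3 : helicoidDim 0 0 (m + 1) N = m + (2 * N + 1) := by
        simp [helicoidDim]; ring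
      rw [h1, h2, h3]
      exact hcone.level_zero
    · have h1 : generalizedHelicoid lam 0 (m + 1) N =
          {p | ∃ Z ∈ {Z | ∃ r : EuclideanSpace ℝ (Fin (m + 1)),
          ∃ Q ∈ (Set.univ : Set (EuclideanSpace ℂ (Fin (N + 1)))), Z = raysVec r Q},
          p = WithLp.toLp 2 (Z, 0)} := by
        ext p
        rw [mem_generalizedHelicoid_iff]
        constructor
        · rintro ⟨Θ, r, Q, hQ, rfl⟩
          exact ⟨_, ⟨r, phase (lam * Θ) • Q, trivial, rfl⟩, by simp [helicoidPoint]⟩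
        · rintro ⟨_, ⟨r, Q, -, rfl⟩, rfl⟩
          obtain ⟨α, hα⟩ := exists_phase_smul_mem_cliffordCone Q
          -- This Θ has phase -α, undoing the rotation that brought Q into the cone; it exists
          -- because λ ≠ 0.
          refine ⟨-α / lam, r, _, hα, ?_⟩
          rw [helicoidPoint, mul_div_cancel₀ _ h, map_smul, smul_smul, ← phase_add,
            neg_add_cancel, phase_zero, one_smul, zero_mul]
      have h2 : helicoidPoint lam 0 Θ r Q =
          WithLp.toLp 2 (raysVec r (phase (lam * Θ) • Q), 0) := by
        simp [helicoidPoint]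
      have h3 : helicoidDim lam 0 (m + 1) N = m + 2 * (N + 1) := by
        simp [helicoidDim, h]; ring
      rw [h1, h2, h3]
      have h4 := hasSmoothChart_univ (phase (lam * Θ) • Q)
      rw [Fintype.card_fin] at h4
      exact (h4.rays (Fintype.card_fin (m + 1)) (fun _ _ _ => Set.mem_univ _)
        (smul_ne_zero (phase_ne_zero _) hQ0) hr).level_zero
  · have h1 : generalizedHelicoid lam lam₀ (m + 1) N =
        {p | ∃ Θ : ℝ, ∃ Z ∈ {Z | ∃ r : EuclideanSpace ℝ (Fin (m + 1)),
        ∃ Q ∈ cliffordCone (Fin (N + 1)), Z = raysVec r Q},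
        p = WithLp.toLp 2 (phase (lam * Θ) • Z, lam₀ * Θ)} := by
      ext p
      rw [mem_generalizedHelicoid_iff]
      constructor
      · rintro ⟨Θ, r, Q, hQ, rfl⟩
        exact ⟨Θ, _, ⟨r, Q, hQ, rfl⟩, rfl⟩
      · rintro ⟨Θ, _, ⟨r, Q, hQ, rfl⟩, rfl⟩
        exact ⟨Θ, r, Q, hQ, rfl⟩
    have h3 : helicoidDim lam lam₀ (m + 1) N = m + (2 * N + 1) + 1 := by
      simp [helicoidDim, h0]; ring
    rw [h1, h3]
    exact hcone.screw h0 Θ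

theorem regularPart_generalizedHelicoid_of_fst_ne_zero (hL : 1 ≤ L) (lam lam₀ : ℝ)
    {p : HelicoidSpace L N} (hp : p ∈ generalizedHelicoid lam lam₀ L N) (h : p.fst ≠ 0) :
    p ∈ regularPart (helicoidDim lam lam₀ L N) (generalizedHelicoid lam lam₀ L N) := by
  obtain ⟨Θ, r, Q, hQ, rfl⟩ := mem_generalizedHelicoid_iff.1 hp
  refine helicoidPoint_mem_regularPart hL lam lam₀ Θ ?_ hQ ?_
  · rintro rfl
    exact h (by simp [helicoidPoint, raysVec_zero])
  · rintro rfl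
    exact h (by simp [helicoidPoint])

open Filter Topology in
theorem generalizedHelicoid_subset_closure_regularPart (hL : 1 ≤ L) (lam lam₀ : ℝ) :
    generalizedHelicoid lam lam₀ L N ⊆
      closure (regularPart (helicoidDim lam lam₀ L N) (generalizedHelicoid lam lam₀ L N)) := by
  intro p hp
  by_cases h : p.fst = 0
  · obtain ⟨Θ, r, Q, hQ, rfl⟩ := mem_generalizedHelicoid_iff.1 hp
    -- The representation of an axis point may have r = 0 or Q = 0, so it is replaced by a fixed
    -- nonzero ray, scaled down to the axis at the same Θ.
    set r₁ : EuclideanSpace ℝ (Fin L) := EuclideanSpace.single ⟨0, hL⟩ 1 with hr₁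
    have hr₁0 : r₁ ≠ 0 := by simp [hr₁]
    set Q₁ : EuclideanSpace ℂ (Fin (N + 1)) :=
      complexVec (EuclideanSpace.single 0 1) (EuclideanSpace.single 0 1) with hQ₁
    have hQ₁K : Q₁ ∈ cliffordCone (Fin (N + 1)) := by simp [hQ₁, cliffordCone]
    have hQ₁0 : Q₁ ≠ 0 := by
      intro h0
      have := congrArg reVec h0
      rw [hQ₁, reVec_complexVec, map_zero] at this
      simp at this
    have hlim : Tendsto (fun t : ℝ => helicoidPoint lam lam₀ Θ (t • r₁) Q₁) (𝓝[≠] 0)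
        (𝓝 (helicoidPoint lam lam₀ Θ r Q)) := by
      have h1 : helicoidPoint lam lam₀ Θ r Q = helicoidPoint lam lam₀ Θ ((0 : ℝ) • r₁) Q₁ := by
        have h2 : phase (lam * Θ) • raysVec r Q = 0 := h
        rw [helicoidPoint, helicoidPoint, h2, zero_smul, raysVec_zero, smul_zero]
      rw [h1]
      refine Tendsto.mono_left (Continuous.tendsto ?_ 0) nhdsWithin_le_nhds
      simp only [helicoidPoint, raysVec_smul]
      have hc : Continuous fun t : ℝ => (phase (lam * Θ) • t • raysVec r₁ Q₁, lam₀ * Θ) := by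
        fun_prop
      exact (WithLp.contDiff_toLp (𝕜 := ℝ) (n := 0)).continuous.comp hc
    refine mem_closure_of_tendsto hlim ?_
    filter_upwards [self_mem_nhdsWithin] with t ht
    exact helicoidPoint_mem_regularPart hL lam lam₀ Θ (smul_ne_zero ht hr₁0) hQ₁K hQ₁0
  · exact subset_closure (regularPart_generalizedHelicoid_of_fst_ne_zero hL lam lam₀ hp h)

theorem multiScrewMotion_helicoidPoint (lam lam₀ θ Θ : ℝ) (r : EuclideanSpace ℝ (Fin L))
    (Q : EuclideanSpace ℂ (Fin (N + 1))) :
    multiScrewMotion lam₀ (fun _ : Fin L => lam) θ (helicoidPoint lam lam₀ Θ r Q) =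
      helicoidPoint lam lam₀ (Θ + θ) r Q := by
  refine WithLp.ofLp_injective 2 (Prod.ext ?_ ?_)
  · ext sk
    change phase (lam * θ) * (phase (lam * Θ) * raysVec r Q sk) =
      phase (lam * (Θ + θ)) * raysVec r Q sk
    rw [← mul_assoc, ← phase_add]
    ring_nf
  · change lam₀ * Θ + lam₀ * θ = lam₀ * (Θ + θ)
    ring

theorem multiScrewMotion_image_generalizedHelicoid (lam lam₀ θ : ℝ) :
    multiScrewMotion lam₀ (fun _ : Fin L => lam) θ '' generalizedHelicoid lam lam₀ L N =
      generalizedHelicoid lam lam₀ L N := by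
  ext p
  constructor
  · rintro ⟨q, hq, rfl⟩
    obtain ⟨Θ, r, Q, hQ, rfl⟩ := mem_generalizedHelicoid_iff.1 hq
    rw [multiScrewMotion_helicoidPoint]
    exact helicoidPoint_mem _ _ _ _ hQ
  · intro hp
    obtain ⟨Θ, r, Q, hQ, rfl⟩ := mem_generalizedHelicoid_iff.1 hp
    refine ⟨helicoidPoint lam lam₀ (Θ - θ) r Q, helicoidPoint_mem _ _ _ _ hQ, ?_⟩
    rw [multiScrewMotion_helicoidPoint, sub_add_cancel]

end HelicoidRegular

/-- The generalized helicoid is a minimal variety, smooth away from the axis `{0} × ℝ`,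
and it is invariant under the multi-screw motion whose pitches are all `λ`, with translation `λ₀`. -/
theorem theorem3 (L N : ℕ) (hL : 1 ≤ L) (lam lam₀ : ℝ) :
    IsMinimalVariety (helicoidDim lam lam₀ L N) (generalizedHelicoid lam lam₀ L N) ∧
    (∀ p ∈ generalizedHelicoid lam lam₀ L N, p.fst ≠ 0 →
      p ∈ regularPart (helicoidDim lam lam₀ L N) (generalizedHelicoid lam lam₀ L N)) ∧
    (∀ θ : ℝ, multiScrewMotion lam₀ (fun _ : Fin L => lam) θ '' generalizedHelicoid lam lam₀ L N =
      generalizedHelicoid lam lam₀ L N) :=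
  ⟨⟨generalizedHelicoid_subset_closure_regularPart hL lam lam₀,
    fun _ _ hf _ hu => meanCurvatureVector_generalizedHelicoid hf hu⟩,
    fun _ hp h => regularPart_generalizedHelicoid_of_fst_ne_zero hL lam lam₀ hp h,
    multiScrewMotion_image_generalizedHelicoid lam lam₀⟩
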